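/- All spaces are compactly generated and products are taken in the category of compactly generated spaces. Let $X$ be a path connected compactly generated space with a nondegenerate basepoint $*$ (that is, $(X,\{*\})$ is an NDR-pair), and suppose that $X$ has weak LS-category less than $2$, i.e. the reduced diagonal $\bar\Delta\colon X\to X\wedge X$, $x\mapsto x\wedge x$, is null homotopic. Let $J(X)$ be the James construction, i.e. the free monoid on $X$ modulo the relation that $*$ is the unit, with the quotient topology from $\bigsqcup_{k\ge 0}X^k$, and let $E\colon X\to J(X)$ be the canonical inclusion. For $n\ge 0$ let $[X^n,J(X)]$ be the set of pointed homotopy classes of pointed maps with the pointwise product; let $p_i\colon X^n\to X$ be the $i$-th coordinate projection, and let $K_n(X)$ be the subgroup of $[X^n,J(X)]$ generated by the classes $[E\circ p_i]$, $1\le i\le n$. Write $[a,b]=a^{-1}b^{-1}ab$ and $[[a_1,\dots,a_l]]=[\cdots[[a_1,a_2],a_3],\cdots,a_l]$ (so $[[a_1]]=a_1$). Let $K_n$ be Cohen's group, the quotient of the free group on $x_1,\dots,x_n$ by the relations 1. $[[x_{i_1},x_{i_2},\dots,x_{i_l}]]=1$ whenever $i_s=i_t$ for some $1\le s<t\le l$;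 2. $[[x_{i_1}^{n_1},x_{i_2}^{n_2},\dots,x_{i_l}^{n_l}]]=[[x_{i_1},x_{i_2},\dots,x_{i_l}]]^{n_1n_2\cdots n_l}$ for all $l\ge 1$, all indices $i_1,\dots,i_l$ and all integers $n_1,\dots,n_l$. Then $[X^n,J(X)]$ is a group, and there is a group homomorphism $$e_X\colon K_n\longrightarrow K_n(X)\subseteq[X^n,J(X)]$$ with $e_X(x_i)=[E\circ p_i]$ for $1\le i\le n$. -/

import Mathlib

open Topology
open scoped unitInterval

universe u

noncomputable section

/-! ### Compactly generated products -/

/-- The `n`-fold Cartesian power of `X` in the category of compactly generated spaces: the set of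
`n`-tuples, with the compactly generated refinement of the product topology. -/
abbrev KPow (X : Type u) [TopologicalSpace X] (n : ℕ) : Type u :=
  WithGeneratedByTopology (fun K : CompHaus.{u} => (K : Type u)) (Fin n → X)

/-- The point of `KPow X n` with coordinates `x`. -/
def KPow.mk {X : Type u} [TopologicalSpace X] {n : ℕ} (x : Fin n → X) : KPow X n :=
  WithGeneratedByTopology.equiv.symm x

/-- The `i`-th coordinate of a point of `KPow X n`. -/
def KPow.coord {X : Type u} [TopologicalSpace X] {n : ℕ} (x : KPow X n) (i : Fin n) : X :=
  WithGeneratedByTopology.equiv x i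

theorem KPow.continuous_coord {X : Type u} [TopologicalSpace X] {n : ℕ} (i : Fin n) :
    Continuous fun x : KPow X n => x.coord i :=
  (continuous_apply i).comp WithGeneratedByTopology.continuous_equiv

theorem KPow.continuous_comp_mk {X : Type u} [TopologicalSpace X] {K : Type u}
    [TopologicalSpace K] [CompactSpace K] [T2Space K] {n : ℕ} {f : K → Fin n → X}
    (hf : Continuous f) : Continuous fun k => KPow.mk (f k) := by
  rw [continuous_def]
  intro U hU
  rw [WithGeneratedByTopology.isOpen_iff] at hU
  exact hU (i := CompHaus.of K) ⟨f, hf⟩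

instance KPow.compactlyGeneratedSpace (X : Type u) [TopologicalSpace X] (n : ℕ) :
    CompactlyGeneratedSpace (KPow X n) := by
  refine compactlyGeneratedSpace_of_isOpen fun s hs => ?_
  rw [WithGeneratedByTopology.isOpen_iff]
  intro K f
  exact hs K (fun k => KPow.mk (f k)) (KPow.continuous_comp_mk f.continuous)

/-- A map into `KPow X n` from a compactly generated space is continuous when its coordinates
are. -/
theorem KPow.continuous_mk {X : Type u} [TopologicalSpace X] {Z : Type u} [TopologicalSpace Z]
    [CompactlyGeneratedSpace Z] {n : ℕ} {f : Z → Fin n → X} (hf : Continuous f) :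
    Continuous fun z => KPow.mk (f z) :=
  continuous_from_compactlyGeneratedSpace _ fun K _ _ _ g hg =>
    KPow.continuous_comp_mk (K := K) (f := fun k => f (g k)) (hf.comp hg)

/-! ### Nondegenerate basepoints, smash powers and weak LS-category -/

/-- The basepoint `x₀` is nondegenerate: `(X, {x₀})` is an NDR-pair. -/
def NondegenerateBasepoint {X : Type u} [TopologicalSpace X] (x₀ : X) : Prop :=
  ∃ (v : C(X, I)) (h : C(X × I, X)),
    (∀ x, v x = 0 ↔ x = x₀) ∧ (∀ x, h (x, 0) = x) ∧ (∀ t, h (x₀, t) = x₀) ∧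
      ∀ x, v x < 1 → h (x, 1) = x₀

/-- The relation on `X ^ k` collapsing the fat wedge (the tuples with at least one coordinate equal
to `x₀`) to one point. -/
def smashSetoid {X : Type u} [TopologicalSpace X] (x₀ : X) (k : ℕ) : Setoid (KPow X k) where
  r x y := x = y ∨ ((∃ i, x.coord i = x₀) ∧ ∃ j, y.coord j = x₀)
  iseqv :=
    { refl := fun _ => Or.inl rfl
      symm := by
        rintro x y (h | ⟨h, h'⟩)
        · exact Or.inl h.symm
        · exact Or.inr ⟨h', h⟩
      trans := by
        rintro x y z (rfl | ⟨h, h'⟩) (rfl | ⟨g, g'⟩)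
        · exact Or.inl rfl
        · exact Or.inr ⟨g, g'⟩
        · exact Or.inr ⟨h, h'⟩
        · exact Or.inr ⟨h, g'⟩ }

/-- The `k`-fold self smash product of `X`, with the quotient topology. -/
abbrev SmashPower {X : Type u} [TopologicalSpace X] (x₀ : X) (k : ℕ) : Type u :=
  Quotient (smashSetoid x₀ k)

/-- The basepoint of the `k`-fold smash product. -/
def SmashPower.base {X : Type u} [TopologicalSpace X] (x₀ : X) (k : ℕ) : SmashPower x₀ k :=
  Quotient.mk _ (KPow.mk fun _ => x₀)

/-- The reduced diagonal `x ↦ x ∧ ⋯ ∧ x`. -/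
def reducedDiagonal {X : Type u} [TopologicalSpace X] [CompactlyGeneratedSpace X] (x₀ : X)
    (k : ℕ) : C(X, SmashPower x₀ k) where
  toFun x := Quotient.mk _ (KPow.mk fun _ => x)
  continuous_toFun := continuous_quotient_mk'.comp
    (KPow.continuous_mk (continuous_pi fun _ => continuous_id))

/-- The weak LS-category of `X` is less than `k`: the `k`-fold reduced diagonal is null homotopic
(through pointed maps). -/
def WeakLSCategoryLT {X : Type u} [TopologicalSpace X] [CompactlyGeneratedSpace X] (x₀ : X)
    (k : ℕ) : Prop :=
  (reducedDiagonal x₀ k).HomotopicRel (ContinuousMap.const X (SmashPower.base x₀ k)) {x₀}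

/-! ### The James construction -/

/-- The single relation imposed on words in the James construction: the basepoint is the unit. -/
def jamesRel {X : Type u} (x₀ : X) (a b : FreeMonoid X) : Prop :=
  a = FreeMonoid.of x₀ ∧ b = 1

/-- The James construction `J(X)`: the free monoid on `X` modulo the relation that the basepoint
is the unit. -/
def James {X : Type u} (x₀ : X) : Type u :=
  PresentedMonoid (jamesRel x₀)

instance James.instMonoid {X : Type u} (x₀ : X) : Monoid (James x₀) :=
  inferInstanceAs (Monoid (PresentedMonoid (jamesRel x₀)))

/-- The point of `J(X)` represented by a tuple `(x₁, …, xₖ)`. -/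
def James.word {X : Type u} [TopologicalSpace X] (x₀ : X) (p : Σ k : ℕ, KPow X k) : James x₀ :=
  PresentedMonoid.mk (jamesRel x₀) (FreeMonoid.ofList (List.ofFn p.2.coord))

/-- `J(X)` has the quotient topology from the disjoint union of the powers `X ^ k`. -/
instance James.instTopologicalSpace {X : Type u} [TopologicalSpace X] (x₀ : X) :
    TopologicalSpace (James x₀) :=
  TopologicalSpace.coinduced (James.word x₀) inferInstance

theorem James.isQuotientMap_word {X : Type u} [TopologicalSpace X] (x₀ : X) :
    IsQuotientMap (James.word x₀) := by
  refine ⟨⟨rfl⟩, fun j => ?_⟩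
  obtain ⟨w, rfl⟩ := PresentedMonoid.surjective_mk (rels := jamesRel x₀) j
  refine ⟨⟨w.toList.length, KPow.mk w.toList.get⟩, ?_⟩
  exact congrArg (fun l => PresentedMonoid.mk (jamesRel x₀) (FreeMonoid.ofList l))
    (List.ofFn_get w.toList)

theorem James.continuous_word {X : Type u} [TopologicalSpace X] (x₀ : X) :
    Continuous (James.word x₀) :=
  (James.isQuotientMap_word x₀).continuous

/-- The canonical inclusion `E : X → J(X)`. -/
def James.E {X : Type u} [TopologicalSpace X] [CompactlyGeneratedSpace X] (x₀ : X) :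
    C(X, James x₀) where
  toFun x := PresentedMonoid.of (jamesRel x₀) x
  continuous_toFun := (James.continuous_word x₀).comp
    (continuous_sigmaMk.comp (KPow.continuous_mk (n := 1) (f := fun (x : X) _ => x)
      (continuous_pi fun _ => continuous_id)))

theorem James.E_base {X : Type u} [TopologicalSpace X] [CompactlyGeneratedSpace X] (x₀ : X) :
    James.E x₀ x₀ = 1 :=
  Quotient.sound (ConGen.Rel.of _ _ ⟨rfl, rfl⟩)

/-! ### Pointwise products of maps into the James construction -/

/-- The `i`-th letter of a word, with the basepoint in place of missing letters. -/
def James.letter {X : Type u} [TopologicalSpace X] (x₀ : X) (i : ℕ) (p : Σ k : ℕ, KPow X k) : X :=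
  if h : i < p.1 then p.2.coord ⟨i, h⟩ else x₀

theorem James.continuous_letter {X : Type u} [TopologicalSpace X] (x₀ : X) (i : ℕ) :
    Continuous (James.letter x₀ i) := by
  refine continuous_sigma fun k => ?_
  by_cases h : i < k
  · simpa [James.letter, h] using KPow.continuous_coord (X := X) ⟨i, h⟩
  · simpa [James.letter, h] using continuous_const

theorem James.word_mul_word {X : Type u} [TopologicalSpace X] (x₀ : X)
    (p q : Σ k : ℕ, KPow X k) : James.word x₀ p * James.word x₀ q =
      James.word x₀ ⟨p.1 + q.1, KPow.mk (Fin.append (fun i : Fin p.1 => James.letter x₀ i p)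
        (fun i : Fin q.1 => James.letter x₀ i q))⟩ := by
  have hp : (fun i : Fin p.1 => James.letter x₀ i p) = p.2.coord := by
    funext i; simp [James.letter]
  have hq : (fun i : Fin q.1 => James.letter x₀ i q) = q.2.coord := by
    funext i; simp [James.letter]
  rw [hp, hq]
  have key : List.ofFn (KPow.mk (Fin.append p.2.coord q.2.coord)).coord =
      List.ofFn p.2.coord ++ List.ofFn q.2.coord :=
    List.ofFn_fin_append p.2.coord q.2.coord
  unfold James.word
  rw [key, FreeMonoid.ofList_append]
  exact (map_mul (PresentedMonoid.mk (jamesRel x₀)) _ _).symm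

theorem James.continuous_word_mul_word {X : Type u} [TopologicalSpace X] (x₀ : X) {K : Type u}
    [TopologicalSpace K] [CompactSpace K] [T2Space K] {a b : K → Σ k : ℕ, KPow X k}
    (ha : Continuous a) (hb : Continuous b) :
    Continuous fun k => James.word x₀ (a k) * James.word x₀ (b k) := by
  have hfst : Continuous fun p : Σ k : ℕ, KPow X k => p.1 :=
    continuous_sigma fun k => continuous_const
  have hlen : Continuous fun k => ((a k).1, (b k).1) := (hfst.comp ha).prodMk (hfst.comp hb)
  rw [continuous_iff_continuousAt]
  intro k₀
  let S : Set K := (fun k => ((a k).1, (b k).1)) ⁻¹' {((a k₀).1, (b k₀).1)}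
  have hSo : IsOpen S := (isOpen_discrete _).preimage hlen
  have hSc : IsClosed S := (isClosed_discrete _).preimage hlen
  have hS : CompactSpace S := isCompact_iff_compactSpace.mp hSc.isCompact
  have hcont : ContinuousOn (fun k => James.word x₀ (a k) * James.word x₀ (b k)) S := by
    rw [continuousOn_iff_continuous_domRestrict]
    have h1 : Continuous fun k : S =>
        James.word x₀ ⟨(a k₀).1 + (b k₀).1, KPow.mk (Fin.append
          (fun i : Fin (a k₀).1 => James.letter x₀ i (a k))
          (fun i : Fin (b k₀).1 => James.letter x₀ i (b k)))⟩ := by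
      refine (James.continuous_word x₀).comp (continuous_sigmaMk.comp
        (KPow.continuous_comp_mk (continuous_pi fun i => ?_)))
      refine Fin.addCases (fun i => ?_) (fun i => ?_) i
      · simpa [Function.comp_def] using
          (James.continuous_letter x₀ i).comp (ha.comp continuous_subtype_val)
      · simpa [Function.comp_def] using
          (James.continuous_letter x₀ i).comp (hb.comp continuous_subtype_val)
    refine h1.congr fun k => ?_
    obtain ⟨k, hk⟩ := k
    have hk' : ((a k).1, (b k).1) = ((a k₀).1, (b k₀).1) := hk
    rw [Prod.mk.injEq] at hk'
    rw [Set.domRestrict_apply, James.word_mul_word, ← hk'.1, ← hk'.2]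
  exact hcont.continuousAt (hSo.mem_nhds rfl)

theorem James.continuous_mul_of_compact {X : Type u} [TopologicalSpace X] (x₀ : X) {K : Type u}
    [TopologicalSpace K] [CompactSpace K] [T2Space K] {f g : K → James x₀}
    (hf : Continuous f) (hg : Continuous g) : Continuous fun k => f k * g k := by
  have step1 : ∀ {L : Type u} [TopologicalSpace L] [CompactSpace L] [T2Space L]
      {a : L → Σ k : ℕ, KPow X k}, Continuous a →
      Continuous fun p : L × James x₀ => James.word x₀ (a p.1) * p.2 := by
    intro L _ _ _ a ha
    refine (James.isQuotientMap_word x₀).continuous_lift_prod_right ?_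
    have hF : ∀ p, Continuous fun l => James.word x₀ (a l) * James.word x₀ p := fun p =>
      James.continuous_word_mul_word x₀ ha continuous_const
    let F : (Σ k : ℕ, KPow X k) → C(L, James x₀) := fun p => ⟨_, hF p⟩
    have hFc : Continuous F := by
      refine continuous_from_compactlyGeneratedSpace F fun M _ _ _ b hb => ?_
      refine ContinuousMap.continuous_of_continuous_uncurry _ ?_
      exact James.continuous_word_mul_word x₀ (K := M × L) (ha.comp continuous_snd)
        (hb.comp continuous_fst)
    exact (ContinuousMap.continuous_uncurry_of_continuous ⟨F, hFc⟩).comp continuous_swap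
  have step2 : Continuous fun p : James x₀ × K => p.1 * g p.2 := by
    refine (James.isQuotientMap_word x₀).continuous_lift_prod_left ?_
    have hF : ∀ p, Continuous fun k => James.word x₀ p * g k := fun p =>
      (step1 (L := PUnit) (a := fun _ => p) continuous_const).comp
        (continuous_const.prodMk hg : Continuous fun k => (PUnit.unit, g k))
    let F : (Σ k : ℕ, KPow X k) → C(K, James x₀) := fun p => ⟨_, hF p⟩
    have hFc : Continuous F := by
      refine continuous_from_compactlyGeneratedSpace F fun L _ _ _ a ha => ?_
      refine ContinuousMap.continuous_of_continuous_uncurry _ ?_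
      exact (step1 ha).comp (continuous_fst.prodMk (hg.comp continuous_snd) :
        Continuous fun p : L × K => (p.1, g p.2))
    exact ContinuousMap.continuous_uncurry_of_continuous ⟨F, hFc⟩
  exact step2.comp (hf.prodMk continuous_id)

theorem James.continuous_mul {X : Type u} [TopologicalSpace X] (x₀ : X) {Z : Type u}
    [TopologicalSpace Z] [CompactlyGeneratedSpace Z] {f g : Z → James x₀}
    (hf : Continuous f) (hg : Continuous g) : Continuous fun z => f z * g z :=
  continuous_from_compactlyGeneratedSpace _ fun K _ _ _ _ hk =>
    James.continuous_mul_of_compact x₀ (K := K) (hf.comp hk) (hg.comp hk)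

theorem James.continuous_mul_prod {X : Type u} [TopologicalSpace X] (x₀ : X) {Z : Type u}
    [TopologicalSpace Z] [CompactlyGeneratedSpace Z] {f g : I × Z → James x₀}
    (hf : Continuous f) (hg : Continuous g) : Continuous fun p => f p * g p := by
  have hF : ∀ z, Continuous fun t : I => f (t, z) * g (t, z) := fun z =>
    (James.continuous_mul x₀ (Z := ULift.{u} I)
      (f := fun t => f (t.down, z)) (g := fun t => g (t.down, z))
      (hf.comp (continuous_uliftDown.prodMk continuous_const))
      (hg.comp (continuous_uliftDown.prodMk continuous_const))).comp continuous_uliftUp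
  let F : Z → C(I, James x₀) := fun z => ⟨_, hF z⟩
  have hFc : Continuous F := by
    refine continuous_from_compactlyGeneratedSpace F fun K _ _ _ k hk => ?_
    refine ContinuousMap.continuous_of_continuous_uncurry _ ?_
    have hs : Continuous fun p : K × I => (p.2, k p.1) :=
      continuous_snd.prodMk (hk.comp continuous_fst)
    exact James.continuous_mul_of_compact x₀ (K := K × I) (hf.comp hs) (hg.comp hs)
  exact (ContinuousMap.continuous_uncurry_of_continuous ⟨F, hFc⟩).comp continuous_swap

/-! ### Pointed homotopy classes -/

/-- Pointed maps `(Z, z₀) → (J(X), 1)`. -/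
def PointedMap {X : Type u} [TopologicalSpace X] {Z : Type u} [TopologicalSpace Z] (z₀ : Z)
    (x₀ : X) : Type u :=
  {f : C(Z, James x₀) // f z₀ = 1}

/-- Pointed homotopy of pointed maps `Z → J(X)`. -/
instance PointedMap.setoid {X : Type u} [TopologicalSpace X] {Z : Type u} [TopologicalSpace Z]
    (z₀ : Z) (x₀ : X) : Setoid (PointedMap z₀ x₀) where
  r f g := f.1.HomotopicRel g.1 {z₀}
  iseqv := ⟨fun f => .refl f.1, fun h => h.symm, fun h h' => h.trans h'⟩

/-- The set `[Z, J(X)]` of pointed homotopy classes of pointed maps. -/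
def HomotopyClass {X : Type u} [TopologicalSpace X] {Z : Type u} [TopologicalSpace Z] (z₀ : Z)
    (x₀ : X) : Type u :=
  Quotient (PointedMap.setoid z₀ x₀)

instance PointedMap.instMonoid {X : Type u} [TopologicalSpace X] {Z : Type u}
    [TopologicalSpace Z] [CompactlyGeneratedSpace Z] (z₀ : Z) (x₀ : X) :
    Monoid (PointedMap z₀ x₀) where
  mul f g := ⟨⟨fun z => f.1 z * g.1 z, James.continuous_mul x₀ f.1.continuous g.1.continuous⟩, by
    change f.1 z₀ * g.1 z₀ = 1
    rw [f.2, g.2, one_mul]⟩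
  one := ⟨ContinuousMap.const Z 1, rfl⟩
  mul_assoc f g h := Subtype.ext (ContinuousMap.ext fun z => mul_assoc (f.1 z) (g.1 z) (h.1 z))
  one_mul f := Subtype.ext (ContinuousMap.ext fun z => one_mul (f.1 z))
  mul_one f := Subtype.ext (ContinuousMap.ext fun z => mul_one (f.1 z))

theorem PointedMap.mul_homotopic {X : Type u} [TopologicalSpace X] {Z : Type u}
    [TopologicalSpace Z] [CompactlyGeneratedSpace Z] {z₀ : Z} {x₀ : X}
    {f f' g g' : PointedMap z₀ x₀} (hf : f ≈ f') (hg : g ≈ g') : f * g ≈ f' * g' := by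
  obtain ⟨F⟩ := hf
  obtain ⟨G⟩ := hg
  refine ⟨⟨⟨⟨fun p => F p * G p, James.continuous_mul_prod x₀ F.continuous G.continuous⟩,
    fun z => ?_, fun z => ?_⟩, fun t z hz => ?_⟩⟩
  · change F (0, z) * G (0, z) = f.1 z * g.1 z
    rw [F.apply_zero, G.apply_zero]
  · change F (1, z) * G (1, z) = f'.1 z * g'.1 z
    rw [F.apply_one, G.apply_one]
  · change F (t, z) * G (t, z) = f.1 z * g.1 z
    rw [F.eq_fst t hz, G.eq_fst t hz]

/-- Pointwise multiplication in `J(X)` makes `[Z, J(X)]` a monoid. -/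
instance HomotopyClass.instMonoid {X : Type u} [TopologicalSpace X] {Z : Type u}
    [TopologicalSpace Z] [CompactlyGeneratedSpace Z] (z₀ : Z) (x₀ : X) :
    Monoid (HomotopyClass z₀ x₀) where
  mul := Quotient.map₂ (· * ·) fun _ _ hf _ _ hg => PointedMap.mul_homotopic hf hg
  one := Quotient.mk _ 1
  mul_assoc := by
    rintro ⟨f⟩ ⟨g⟩ ⟨h⟩
    exact congrArg (Quotient.mk _) (mul_assoc f g h)
  one_mul := by
    rintro ⟨f⟩
    exact congrArg (Quotient.mk _) (one_mul f)
  mul_one := by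
    rintro ⟨f⟩
    exact congrArg (Quotient.mk _) (mul_one f)

/-! ### The geometric Cohen group -/

/-- The monoid `[Xⁿ, J(X)]`. -/
abbrev PowerClass {X : Type u} [TopologicalSpace X] (x₀ : X) (n : ℕ) : Type u :=
  HomotopyClass (Z := KPow X n) (KPow.mk fun _ => x₀) x₀

/-- The pointed map `E ∘ pᵢ : Xⁿ → X → J(X)`. -/
def coordinateMap {X : Type u} [TopologicalSpace X] [CompactlyGeneratedSpace X] (x₀ : X) {n : ℕ}
    (i : Fin n) : PointedMap (Z := KPow X n) (KPow.mk fun _ => x₀) x₀ :=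
  ⟨(James.E x₀).comp ⟨fun x => x.coord i, KPow.continuous_coord i⟩, James.E_base x₀⟩

/-- The class of `E ∘ pᵢ` in `[Xⁿ, J(X)]`. -/
def coordinateClass {X : Type u} [TopologicalSpace X] [CompactlyGeneratedSpace X] (x₀ : X) {n : ℕ}
    (i : Fin n) : PowerClass x₀ n :=
  Quotient.mk _ (coordinateMap x₀ i)

/-- `Kₙ(X)`: the subgroup generated by the classes of `E ∘ pᵢ` in the group of invertible elements
of the monoid `[Xⁿ, J(X)]`. -/
def GeometricCohenGroup {X : Type u} [TopologicalSpace X] [CompactlyGeneratedSpace X] (x₀ : X)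
    (n : ℕ) : Subgroup (PowerClass x₀ n)ˣ :=
  Subgroup.closure {c | ∃ i : Fin n, (c : PowerClass x₀ n) = coordinateClass x₀ i}

/-! ### The combinatorial Cohen group -/

/-- The commutator `[x, y] = x⁻¹ y⁻¹ x y`. -/
def cohenCommutator {G : Type*} [Group G] (x y : G) : G :=
  x⁻¹ * y⁻¹ * x * y

/-- The iterated commutator `[⋯[[a₁, a₂], a₃], ⋯, aₗ]` (which is `a₁` for `l = 1`). -/
def iteratedCommutator {G : Type*} [Group G] : List G → G
  | [] => 1
  | a :: l => l.foldl cohenCommutator a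

/-- The defining relators of Cohen's group: iterated commutators of generators with a repeated
index, and multilinearity of iterated commutators in integral powers of the generators. -/
def cohenRelators (n : ℕ) : Set (FreeGroup (Fin n)) :=
  {r | ∃ l : List (Fin n), ¬ l.Nodup ∧ r = iteratedCommutator (l.map FreeGroup.of)} ∪
  {r | ∃ l : List (Fin n × ℤ),
    r = iteratedCommutator (l.map fun p => FreeGroup.of p.1 ^ p.2) *
      (iteratedCommutator (l.map fun p => FreeGroup.of p.1) ^ (l.map Prod.snd).prod)⁻¹}

/-- Cohen's combinatorial group `Kₙ`. -/
abbrev CohenGroup (n : ℕ) : Type :=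
  PresentedGroup (cohenRelators n)

end

universe v

noncomputable section

/-! ### Compactly generated spaces -/

/-! A null homotopy of the reduced diagonal gives each `x` a track in `X ∧ X` from `x ∧ x` to the
basepoint. While the track avoids the basepoint, its two coordinates are honest paths in `X`
starting at `x`; at some time one of them lies where the collar collapses to `*`. Hence the
complement of `*` is covered by countably many cozero sets contractible in `X`
(`WeakLSCategoryLT.exists_contractible_cover`). Over these and the collar, `E` is null homotopic and
has `1` as a local right homotopy inverse. The local inverses are glued one at a time along explicit
paths (`IsRightInverseOn.extend`, `exists_rightInverse_of_cover`), giving `y` with `E · y` null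
homotopic. On words, up to a collar deformation, `x₁⋯xₖ` has the inverse `y(xₖ)⋯y(x₁)`, the product
being contracted from the inside out (`James.exists_homotopyInverse`). So every class has a right
inverse, and the monoid of classes is a group.

For Cohen's relations, let `Nᵢ` be the kernel of restriction to the hyperplane `zᵢ = *`. It is
normal and contains the class of `E ∘ pᵢ`. It is also abelian
(`PowerClass.commute_of_restrict_eq_one`): for `f`, `g` trivial near the hyperplane, let the `i`-th
coordinates in `f` and `g` vary independently in the difference of `fg` and `gf`. After a
deformation this vanishes as soon as one of the two is `*`, so it factors through `X ∧ X`; the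
actual difference is its pullback along the reduced diagonal, hence null homotopic. In any group,
elements chosen from abelian normal subgroups satisfy Cohen's relations
(`lift_cohenRelators_eq_one`). -/

theorem CompactlyGeneratedSpace.prod_of_locallyCompact (Z : Type u) (W : Type v)
    [TopologicalSpace Z] [CompactlyGeneratedSpace Z] [TopologicalSpace W] [LocallyCompactSpace W]
    [T2Space W] : CompactlyGeneratedSpace (Z × W) := by
  refine compactlyGeneratedSpace_of_continuous_maps fun {Y} _ f hf => ?_
  have hK : ∀ (K : Type u) [TopologicalSpace K] [CompactSpace K] [T2Space K] (g : K → Z),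
      Continuous g → Continuous fun p : K × W => f (g p.1, p.2) := by
    intro K _ _ _ g hg
    have : CompactlyGeneratedSpace (K × W) := inferInstance
    refine continuous_from_compactlyGeneratedSpace _ fun L _ _ _ l hl => ?_
    exact hf L (fun x => (g (l x).1, (l x).2)) (by fun_prop)
  have hF : ∀ z, Continuous fun w : W => f (z, w) := fun z =>
    (hK PUnit (fun _ => z) continuous_const).comp
      (continuous_const.prodMk continuous_id : Continuous fun w : W => (PUnit.unit, w))
  -- Continuity of the curried map needs testing only on compact spaces mapping to `Z`; local
  -- compactness of `W` permits uncurrying.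
  let F : Z → C(W, Y) := fun z => ⟨_, hF z⟩
  have hFc : Continuous F := by
    refine continuous_from_compactlyGeneratedSpace F fun K _ _ _ g hg => ?_
    exact ContinuousMap.continuous_of_continuous_uncurry _ (hK K g hg)
  exact ContinuousMap.continuous_uncurry_of_continuous ⟨F, hFc⟩

instance CompactlyGeneratedSpace.prod_real (Z : Type u) [TopologicalSpace Z]
    [CompactlyGeneratedSpace Z] : CompactlyGeneratedSpace (Z × ℝ) :=
  CompactlyGeneratedSpace.prod_of_locallyCompact Z ℝ

instance CompactlyGeneratedSpace.prod_unitInterval (Z : Type u) [TopologicalSpace Z]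
    [CompactlyGeneratedSpace Z] : CompactlyGeneratedSpace (Z × I) :=
  CompactlyGeneratedSpace.prod_of_locallyCompact Z I

/-- A test map `K → Z` need not land in `V`, but every point of `K` sent into `V` has a compact
neighbourhood that does, and openness is local. -/
theorem IsOpen.compactlyGeneratedSpace {Z : Type u} [TopologicalSpace Z]
    [CompactlyGeneratedSpace Z] {V : Set Z} (hV : IsOpen V) : CompactlyGeneratedSpace V := by
  refine compactlyGeneratedSpace_of_isOpen fun s hs => ?_
  rw [hV.isOpenEmbedding_subtypeVal.isOpen_iff_image_isOpen]
  refine CompactlyGeneratedSpace.isOpen' fun K _ _ _ f hf => ?_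
  rw [isOpen_iff_mem_nhds]
  rintro k ⟨⟨z, hz⟩, hzs, hzk⟩
  obtain ⟨L, hL, hLV, hLc⟩ := local_compact_nhds
    ((hV.preimage hf).mem_nhds (show f k ∈ V from hzk ▸ hz))
  have : CompactSpace L := isCompact_iff_compactSpace.mp hLc
  have hc : Continuous fun l : L => (⟨f l, hLV l.2⟩ : V) :=
    (hf.comp continuous_subtype_val).subtype_mk _
  have ho := hs L _ hc
  obtain ⟨O, hO, hOs⟩ := isOpen_induced_iff.mp ho
  have hkL : k ∈ L := mem_of_mem_nhds hL
  have hkO : k ∈ O := by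
    have : (⟨k, hkL⟩ : L) ∈ Subtype.val ⁻¹' O := by
      rw [hOs]
      change (⟨f k, _⟩ : V) ∈ s
      convert hzs using 2
      exact hzk.symm
    exact this
  filter_upwards [hL, hO.mem_nhds hkO] with l hl hlO
  have : (⟨l, hl⟩ : L) ∈ (fun l : L => (⟨f l, hLV l.2⟩ : V)) ⁻¹' s := by rw [← hOs]; exact hlO
  exact ⟨_, this, rfl⟩

theorem James.continuousOn_mul {X : Type u} [TopologicalSpace X] {x₀ : X} {Z : Type u}
    [TopologicalSpace Z] [CompactlyGeneratedSpace Z] {f g : Z → James x₀} {V : Set Z}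
    (hV : IsOpen V) (hf : ContinuousOn f V) (hg : ContinuousOn g V) :
    ContinuousOn (fun z => f z * g z) V := by
  have := hV.compactlyGeneratedSpace
  rw [continuousOn_iff_continuous_domRestrict] at *
  exact James.continuous_mul x₀ hf hg

instance James.compactlyGeneratedSpace {X : Type u} [TopologicalSpace X] (x₀ : X) :
    CompactlyGeneratedSpace (James x₀) :=
  compactlyGeneratedSpace_of_coinduced (James.continuous_word x₀) rfl

/-! ### Truncation to the unit interval -/

/-- Truncation of a real number to the unit interval. -/
def truncate (t : ℝ) : I := Set.projIcc 0 1 zero_le_one t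

@[fun_prop]
theorem continuous_truncate : Continuous truncate :=
  continuous_projIcc (h := zero_le_one)

theorem truncate_of_nonpos {t : ℝ} (ht : t ≤ 0) : truncate t = 0 :=
  Set.projIcc_of_le_left zero_le_one ht

theorem truncate_of_one_le {t : ℝ} (ht : 1 ≤ t) : truncate t = 1 :=
  Set.projIcc_of_right_le zero_le_one ht

@[simp] theorem truncate_zero : truncate 0 = 0 := truncate_of_nonpos le_rfl

@[simp] theorem truncate_one : truncate 1 = 1 := truncate_of_one_le le_rfl

@[simp] theorem truncate_coe (t : I) : truncate t = t := Set.projIcc_val zero_le_one t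

/-! ### Collars of the basepoint -/

/-- A function vanishing at the basepoint and a deformation of the space collapsing its
neighbourhood `{v < 1}` to the basepoint. -/
structure Collar {X : Type u} [TopologicalSpace X] (x₀ : X) where
  v : X → ℝ
  continuous_v : Continuous v
  v_nonneg : ∀ x, 0 ≤ v x
  v_le_one : ∀ x, v x ≤ 1
  v_eq_zero_iff : ∀ x, v x = 0 ↔ x = x₀
  h : X × I → X
  continuous_h : Continuous h
  h_zero : ∀ x, h (x, 0) = x
  h_base : ∀ t, h (x₀, t) = x₀
  h_one : ∀ x, v x < 1 → h (x, 1) = x₀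

theorem NondegenerateBasepoint.exists_collar {X : Type u} [TopologicalSpace X] {x₀ : X}
    (hx₀ : NondegenerateBasepoint x₀) : Nonempty (Collar x₀) := by
  obtain ⟨v, h, h1, h2, h3, h4⟩ := hx₀
  exact ⟨{
    v := fun x => v x
    continuous_v := by fun_prop
    v_nonneg := fun x => (v x).2.1
    v_le_one := fun x => (v x).2.2
    v_eq_zero_iff := fun x => by rw [← h1]; exact Set.Icc.coe_eq_zero
    h := h
    continuous_h := h.continuous
    h_zero := h2
    h_base := h3
    h_one := fun x hx => h4 x (by exact_mod_cast hx) }⟩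

attribute [fun_prop] Collar.continuous_v Collar.continuous_h

theorem Collar.v_base {X : Type u} [TopologicalSpace X] {x₀ : X} (c : Collar x₀) : c.v x₀ = 0 :=
  (c.v_eq_zero_iff x₀).2 rfl

/-! ### Homotopies and classes -/

/-- The class of a pointed map. -/
def HomotopyClass.mk {X : Type u} [TopologicalSpace X] {Z : Type u} [TopologicalSpace Z] {z₀ : Z}
    {x₀ : X} (f : PointedMap z₀ x₀) : HomotopyClass z₀ x₀ :=
  Quotient.mk _ f

theorem HomotopyClass.mk_eq_of_homotopy {X : Type u} [TopologicalSpace X] {Z : Type u}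
    [TopologicalSpace Z] {z₀ : Z} {x₀ : X} {f g : PointedMap z₀ x₀} (H : Z × I → James x₀)
    (hH : Continuous H) (h0 : ∀ z, H (z, 0) = f.1 z) (h1 : ∀ z, H (z, 1) = g.1 z)
    (hb : ∀ t, H (z₀, t) = 1) : HomotopyClass.mk f = HomotopyClass.mk g := by
  refine Quotient.sound ⟨⟨⟨⟨fun p => H (p.2, p.1), by fun_prop⟩, h0, h1⟩, ?_⟩⟩
  rintro t z rfl
  exact (hb t).trans f.2.symm

theorem HomotopyClass.exists_homotopy {X : Type u} [TopologicalSpace X] {Z : Type u}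
    [TopologicalSpace Z] {z₀ : Z} {x₀ : X} {f g : PointedMap z₀ x₀}
    (h : HomotopyClass.mk f = HomotopyClass.mk g) :
    ∃ H : Z × I → James x₀, Continuous H ∧ (∀ z, H (z, 0) = f.1 z) ∧ (∀ z, H (z, 1) = g.1 z) ∧
      ∀ t, H (z₀, t) = 1 := by
  obtain ⟨H⟩ : f.1.HomotopicRel g.1 {z₀} := Quotient.exact h
  refine ⟨fun p => H (p.2, p.1), by fun_prop, H.apply_zero, H.apply_one, fun t => ?_⟩
  exact (H.eq_fst t rfl).trans f.2

theorem HomotopyClass.mk_surjective {X : Type u} [TopologicalSpace X] {Z : Type u}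
    [TopologicalSpace Z] {z₀ : Z} {x₀ : X} (c : HomotopyClass z₀ x₀) : ∃ f, mk f = c :=
  Quotient.exists_rep c

theorem HomotopyClass.mk_mul {X : Type u} [TopologicalSpace X] {Z : Type u}
    [TopologicalSpace Z] [CompactlyGeneratedSpace Z] {z₀ : Z} {x₀ : X} (f g : PointedMap z₀ x₀) :
    mk (f * g) = mk f * mk g := rfl

theorem HomotopyClass.mk_one {X : Type u} [TopologicalSpace X] {Z : Type u}
    [TopologicalSpace Z] [CompactlyGeneratedSpace Z] {z₀ : Z} {x₀ : X} :
    mk (1 : PointedMap z₀ x₀) = 1 := rfl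

/-! ### Null homotopies of the reduced diagonal -/

namespace Collar

variable {X : Type u} [TopologicalSpace X] {x₀ : X} (c : Collar x₀)

theorem v_eq_zero_of_exists {p : KPow X 2} (hp : ∃ i, p.coord i = x₀) :
    min (c.v (p.coord 0)) (c.v (p.coord 1)) = 0 := by
  obtain ⟨i, hi⟩ := hp
  fin_cases i
  · have : c.v (p.coord 0) = 0 := (c.v_eq_zero_iff _).2 hi
    rw [this]; exact min_eq_left (c.v_nonneg _)
  · have : c.v (p.coord 1) = 0 := (c.v_eq_zero_iff _).2 hi
    rw [this]; exact min_eq_right (c.v_nonneg _)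

theorem not_exists_of_pos {p : KPow X 2} (hp : 0 < min (c.v (p.coord 0)) (c.v (p.coord 1))) :
    ¬ ∃ i, p.coord i = x₀ :=
  fun h => hp.ne' (c.v_eq_zero_of_exists h)

/-- The distance function to the basepoint of `X ∧ X`. -/
def smashMin : SmashPower x₀ 2 → ℝ :=
  Quotient.lift (fun p => min (c.v (p.coord 0)) (c.v (p.coord 1))) (by
    rintro p q (rfl | ⟨hp, hq⟩)
    · rfl
    · rw [c.v_eq_zero_of_exists hp, c.v_eq_zero_of_exists hq])

/-- A function on `X ∧ X` that is positive where no coordinate is at the basepoint and the `j`-th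
coordinate is close to it. -/
def smashSide (j : Fin 2) : SmashPower x₀ 2 → ℝ :=
  Quotient.lift
    (fun p => min (min (c.v (p.coord 0)) (c.v (p.coord 1))) (1 - c.v (p.coord j))) (by
    rintro p q (rfl | ⟨hp, hq⟩)
    · rfl
    · rw [c.v_eq_zero_of_exists hp, c.v_eq_zero_of_exists hq,
        min_eq_left (sub_nonneg.2 (c.v_le_one _)), min_eq_left (sub_nonneg.2 (c.v_le_one _))])

open Classical in
/-- The `j`-th coordinate of a point of `X ∧ X`. -/
def smashCoord (_c : Collar x₀) (j : Fin 2) : SmashPower x₀ 2 → X :=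
  Quotient.lift (fun p => if ∃ i, p.coord i = x₀ then x₀ else p.coord j) (by
    rintro p q (rfl | ⟨hp, hq⟩)
    · rfl
    · rw [if_pos hp, if_pos hq])

theorem continuous_smashMin : Continuous c.smashMin :=
  Continuous.quotient_lift ((c.continuous_v.comp (KPow.continuous_coord 0)).min
    (c.continuous_v.comp (KPow.continuous_coord 1))) _

theorem continuous_smashSide (j : Fin 2) : Continuous (c.smashSide j) :=
  Continuous.quotient_lift (((c.continuous_v.comp (KPow.continuous_coord 0)).min
    (c.continuous_v.comp (KPow.continuous_coord 1))).min
      (continuous_const.sub (c.continuous_v.comp (KPow.continuous_coord j)))) _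

theorem smashCoord_mk {j : Fin 2} {p : KPow X 2}
    (hp : 0 < min (c.v (p.coord 0)) (c.v (p.coord 1))) :
    c.smashCoord j (Quotient.mk _ p) = p.coord j :=
  if_neg (c.not_exists_of_pos hp)

/-- Off the fat wedge the quotient map is injective, so the coordinate is well defined there and
continuity can be read off in `X²`. -/
theorem continuousOn_smashCoord (j : Fin 2) :
    ContinuousOn (c.smashCoord j) {q | 0 < c.smashMin q} := by
  rw [continuousOn_open_iff (isOpen_lt continuous_const c.continuous_smashMin)]
  intro U hU
  rw [← isQuotientMap_quotient_mk'.isOpen_preimage]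
  have : IsOpen ({p : KPow X 2 | 0 < min (c.v (p.coord 0)) (c.v (p.coord 1))} ∩
      (fun p : KPow X 2 => p.coord j) ⁻¹' U) := by
    refine (isOpen_lt continuous_const ?_).inter (hU.preimage (KPow.continuous_coord j))
    exact (c.continuous_v.comp (KPow.continuous_coord 0)).min
      (c.continuous_v.comp (KPow.continuous_coord 1))
  convert this using 1
  ext p
  refine and_congr_right fun hp => ?_
  change c.smashCoord j (Quotient.mk _ p) ∈ U ↔ _
  rw [c.smashCoord_mk hp]
  rfl

theorem v_smashCoord {j : Fin 2} {q : SmashPower x₀ 2} (hq : 0 < c.smashSide j q) :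
    c.v (c.smashCoord j q) < 1 := by
  induction q using Quotient.inductionOn with
  | h p =>
    obtain ⟨h1, h2⟩ := lt_min_iff.1 (show 0 < min _ (1 - c.v (p.coord j)) from hq)
    rw [c.smashCoord_mk h1]
    linarith

theorem exists_smashSide_pos {q : SmashPower x₀ 2} (h0 : 0 < c.smashMin q)
    (h1 : c.smashMin q < 1) : ∃ j, 0 < c.smashSide j q := by
  induction q using Quotient.inductionOn with
  | h p =>
    replace h1 : min (c.v (p.coord 0)) (c.v (p.coord 1)) < 1 := h1
    rcases min_lt_iff.1 h1 with h | h
    · exact ⟨0, lt_min h0 (sub_pos.2 h)⟩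
    · exact ⟨1, lt_min h0 (sub_pos.2 h)⟩

theorem smashMin_diagonal [CompactlyGeneratedSpace X] (x : X) :
    c.smashMin (reducedDiagonal x₀ 2 x) = c.v x :=
  min_self _

theorem smashCoord_diagonal [CompactlyGeneratedSpace X] {j : Fin 2} {x : X} (hx : 0 < c.v x) :
    c.smashCoord j (reducedDiagonal x₀ 2 x) = x :=
  c.smashCoord_mk (p := KPow.mk fun _ => x) (lt_min hx hx)

/-- The least distance to the basepoint along the initial part `[0, q]` of the track of a point
under a homotopy in `X ∧ X`. -/
def trackMin (G : X × I → SmashPower x₀ 2) (p : X × I) : ℝ :=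
  sInf ((fun t : I => c.smashMin (G (p.1, t * p.2))) '' Set.univ)

variable {G : X × I → SmashPower x₀ 2}

theorem continuous_trackMin (hG : Continuous G) : Continuous (c.trackMin G) := by
  refine isCompact_univ.continuous_sInf
    (f := fun (p : X × I) (t : I) => c.smashMin (G (p.1, t * p.2))) ?_
  exact c.continuous_smashMin.comp (hG.comp (by fun_prop))

theorem trackMin_pos_iff (hG : Continuous G) (p : X × I) :
    0 < c.trackMin G p ↔ ∀ t : I, 0 < c.smashMin (G (p.1, t * p.2)) := by
  have hc : Continuous fun t : I => c.smashMin (G (p.1, t * p.2)) :=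
    c.continuous_smashMin.comp (hG.comp (by fun_prop))
  obtain ⟨t, -, ht, hmin⟩ := isCompact_univ.exists_sInf_image_eq_and_le
    (Set.univ_nonempty (α := I)) hc.continuousOn
  have ht' : c.trackMin G p = c.smashMin (G (p.1, t * p.2)) := ht
  rw [ht']
  exact ⟨fun h s => h.trans_le (hmin s trivial), fun h => h t⟩

/-- If `v x < 1`, time `0` works, since `x` already lies in the collar. If `v x = 1`, then
`smashMin` runs from `1` to `0` along the track. At the first time it equals `1 / 2`, the track has
so far stayed away from the basepoint and some coordinate has `v = 1 / 2 < 1`. -/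
theorem exists_good_time [CompactlyGeneratedSpace X] (hG : Continuous G)
    (h0 : ∀ x, G (x, 0) = reducedDiagonal x₀ 2 x)
    (h1 : ∀ x, G (x, 1) = SmashPower.base x₀ 2) {x : X} (hx₀ : 0 < c.v x) :
    ∃ q : I, ∃ j, 0 < min (c.trackMin G (x, q)) (c.smashSide j (G (x, q))) := by
  rcases (c.v_le_one x).lt_or_eq with hx | hx
  · obtain ⟨j, hj⟩ := c.exists_smashSide_pos (q := G (x, 0)) (by rwa [h0, smashMin_diagonal])
      (by rwa [h0, smashMin_diagonal])
    refine ⟨0, j, lt_min ((c.trackMin_pos_iff hG _).2 fun t => ?_) hj⟩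
    simpa [h0, c.smashMin_diagonal] using hx₀
  have hc : Continuous fun t : I => c.smashMin (G (x, t)) :=
    c.continuous_smashMin.comp (hG.comp (by fun_prop))
  have hm0 : c.smashMin (G (x, 0)) = 1 := by rw [h0, smashMin_diagonal, hx]
  have hm1 : c.smashMin (G (x, 1)) = 0 := by
    rw [h1]
    exact c.v_eq_zero_of_exists (p := KPow.mk fun _ => x₀) ⟨0, rfl⟩
  have hcl : IsClosed {t : I | c.smashMin (G (x, t)) ≤ 1 / 2} := isClosed_le hc continuous_const
  obtain ⟨q, hq, hmin⟩ := hcl.isCompact.exists_isLeast ⟨1, by norm_num [hm1]⟩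
  have hlt : ∀ t < q, 1 / 2 < c.smashMin (G (x, t)) := fun t ht => by
    by_contra hh
    exact absurd (hmin (show t ∈ _ from not_lt.1 hh)) (not_le.2 ht)
  have hq2 : c.smashMin (G (x, q)) = 1 / 2 := by
    refine le_antisymm hq ?_
    have hq0 : (0 : I) < q := by
      refine lt_of_le_of_ne q.2.1 fun h => ?_
      have h' : q = 0 := h.symm
      have : c.smashMin (G (x, q)) ≤ 1 / 2 := hq
      rw [h', hm0] at this
      norm_num at this
    have hcl' : IsClosed {t : I | 1 / 2 ≤ c.smashMin (G (x, t))} :=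
      isClosed_le continuous_const hc
    have hne : (Set.Iio q).Nonempty := ⟨0, hq0⟩
    have hcq : q ∈ closure (Set.Iio q) := by
      rw [closure_Iio' hne]; exact Set.mem_Iic.2 le_rfl
    exact hcl'.closure_subset_iff.2 (fun t ht => (hlt t ht).le) hcq
  obtain ⟨j, hj⟩ := c.exists_smashSide_pos (q := G (x, q)) (by rw [hq2]; norm_num)
    (by rw [hq2]; norm_num)
  refine ⟨q, j, lt_min ?_ hj⟩
  rw [c.trackMin_pos_iff hG]
  intro t
  have hle : t * q ≤ q := mul_le_of_le_one_left q.2.1 t.2.2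
  rcases hle.lt_or_eq with h | h
  · exact lt_trans (by norm_num) (hlt _ h)
  · dsimp only
    rw [h, hq2]; norm_num

/-- Following the `j`-th coordinate of a track in `X ∧ X` until time `q`, and the collar
afterwards. -/
def trackContraction (G : X × I → SmashPower x₀ 2) (q : I) (j : Fin 2) (p : X × I) : X :=
  if (p.2 : ℝ) ≤ 1 / 2 then c.smashCoord j (G (p.1, truncate (2 * p.2) * q))
  else c.h (c.smashCoord j (G (p.1, q)), truncate (2 * p.2 - 1))

theorem continuousOn_trackContraction (hG : Continuous G) (q : I) (j : Fin 2) :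
    ContinuousOn (c.trackContraction G q j)
      ({x | 0 < min (c.trackMin G (x, q)) (c.smashSide j (G (x, q)))} ×ˢ Set.univ) := by
  have hpos : ∀ p ∈ ({x | 0 < min (c.trackMin G (x, q)) (c.smashSide j (G (x, q)))} ×ˢ
      (Set.univ : Set I)), ∀ t : I, 0 < c.smashMin (G (p.1, t * q)) := fun p hp =>
    (c.trackMin_pos_iff hG (p.1, q)).1 (lt_min_iff.1 hp.1).1
  have hA : ContinuousOn
      (fun p : X × I => c.smashCoord j (G (p.1, truncate (2 * p.2) * q)))
      ({x | 0 < min (c.trackMin G (x, q)) (c.smashSide j (G (x, q)))} ×ˢ Set.univ) := by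
    refine (c.continuousOn_smashCoord j).comp (Continuous.continuousOn (by fun_prop))
      fun p hp => hpos p hp _
  have hB : ContinuousOn
      (fun p : X × I => c.h (c.smashCoord j (G (p.1, q)), truncate (2 * p.2 - 1)))
      ({x | 0 < min (c.trackMin G (x, q)) (c.smashSide j (G (x, q)))} ×ˢ Set.univ) := by
    refine c.continuous_h.comp_continuousOn (ContinuousOn.prodMk ?_
      (Continuous.continuousOn (by fun_prop)))
    refine (c.continuousOn_smashCoord j).comp (Continuous.continuousOn (by fun_prop))
      fun p hp => ?_
    simpa using hpos p hp 1
  refine ContinuousOn.if ?_ (hA.mono Set.inter_subset_left) (hB.mono Set.inter_subset_left)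
  rintro p ⟨-, hp⟩
  have hp2 : (p.2 : ℝ) = 1 / 2 :=
    frontier_le_subset_eq (by fun_prop : Continuous fun p : X × I => (p.2 : ℝ))
      continuous_const hp
  rw [hp2, truncate_of_one_le (by norm_num), truncate_of_nonpos (by norm_num), c.h_zero, one_mul]

theorem trackContraction_zero [CompactlyGeneratedSpace X]
    (h0 : ∀ x, G (x, 0) = reducedDiagonal x₀ 2 x) {q : I} {j : Fin 2}
    {x : X} (hx : 0 < c.v x) : c.trackContraction G q j (x, 0) = x := by
  simp [trackContraction, h0, c.smashCoord_diagonal hx]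

theorem trackContraction_one {q : I} {j : Fin 2} {x : X} (hx : 0 < c.smashSide j (G (x, q))) :
    c.trackContraction G q j (x, 1) = x₀ := by
  have h : truncate (2 * 1 - 1) = 1 := truncate_of_one_le (by norm_num)
  have h2 : ¬ (((x, (1 : I)) : X × I).2 : ℝ) ≤ 1 / 2 := by norm_num
  rw [trackContraction, if_neg h2]
  change c.h (_, truncate (2 * 1 - 1)) = _
  rw [h, c.h_one _ (c.v_smashCoord hx)]

end Collar

/-- Being a good time is an open condition, so good times can be taken from a dense sequence. This
makes the cover countable, as the inductive gluing requires. -/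
theorem WeakLSCategoryLT.exists_contractible_cover {X : Type u} [TopologicalSpace X]
    [CompactlyGeneratedSpace X] {x₀ : X} (hcat : WeakLSCategoryLT x₀ 2) (c : Collar x₀) :
    ∃ (u : ℕ → X → ℝ) (K : ℕ → X × I → X), (∀ i, Continuous (u i)) ∧
      (∀ i, ContinuousOn (K i) ({x | 0 < u i x} ×ˢ Set.univ)) ∧
      (∀ i x, 0 < u i x → K i (x, 0) = x ∧ K i (x, 1) = x₀) ∧ ∀ x, 0 < c.v x → ∃ i, 0 < u i x := by
  obtain ⟨G'⟩ := hcat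
  let G : X × I → SmashPower x₀ 2 := fun p => G' (p.2, p.1)
  have hG : Continuous G := G'.continuous.comp continuous_swap
  have h0 : ∀ x, G (x, 0) = reducedDiagonal x₀ 2 x := G'.apply_zero
  have h1 : ∀ x, G (x, 1) = SmashPower.base x₀ 2 := G'.apply_one
  obtain ⟨e, he⟩ := exists_surjective_nat (ℕ × Fin 2)
  let q : ℕ → I := fun i => TopologicalSpace.denseSeq I (e i).1
  let j : ℕ → Fin 2 := fun i => (e i).2
  have hcont : ∀ j, Continuous fun p : X × I => min (c.trackMin G p) (c.smashSide j (G p)) :=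
    fun j => (c.continuous_trackMin hG).min ((c.continuous_smashSide j).comp hG)
  refine ⟨fun i x => min (c.trackMin G (x, q i)) (c.smashSide (j i) (G (x, q i))),
    fun i => c.trackContraction G (q i) (j i), fun i => ?_, fun i => ?_, fun i x hx => ?_,
    fun x hx => ?_⟩
  · exact (hcont (j i)).comp (by fun_prop : Continuous fun x => (x, q i))
  · exact c.continuousOn_trackContraction hG (q i) (j i)
  · obtain ⟨ha, hb⟩ := lt_min_iff.1 hx
    refine ⟨c.trackContraction_zero h0 ?_, c.trackContraction_one hb⟩
    have := (c.trackMin_pos_iff hG _).1 ha 0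
    simpa [h0, c.smashMin_diagonal] using this
  · obtain ⟨r, k, hr⟩ := c.exists_good_time hG h0 h1 hx
    have ho : IsOpen {s : I | 0 < min (c.trackMin G (x, s)) (c.smashSide k (G (x, s)))} :=
      isOpen_lt continuous_const ((hcont k).comp (by fun_prop : Continuous fun s => (x, s)))
    obtain ⟨_, hs, n, rfl⟩ := (TopologicalSpace.denseRange_denseSeq I).inter_open_nonempty _ ho
      ⟨r, hr⟩
    obtain ⟨i, hi⟩ := he (n, k)
    refine ⟨i, ?_⟩
    simpa [q, j, hi] using hs

/-! ### Gluing local homotopy inverses -/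

/-- A pointwise right inverse `y` of `e` over `V`, up to the homotopy `γ`. -/
structure IsRightInverseOn {X : Type u} [TopologicalSpace X] {x₀ : X} (e : X → James x₀)
    (V : Set X) (y : X → James x₀) (γ : X × I → James x₀) : Prop where
  continuousOn_fst : ContinuousOn y V
  continuousOn_snd : ContinuousOn γ (V ×ˢ Set.univ)
  zero : ∀ x ∈ V, γ (x, 0) = e x * y x
  one : ∀ x ∈ V, γ (x, 1) = 1

section Extension

variable {X : Type u} {x₀ : X} {e y : X → James x₀} {γ K : X × I → James x₀} {a w : X → ℝ}

/-- The path from `y x` to the unit running through `e x * y x`. -/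
def inversePath (y : X → James x₀) (γ K : X × I → James x₀) (p : X × ℝ) : James x₀ :=
  if p.2 ≤ 1 then K (p.1, truncate (1 - p.2)) * y p.1 else γ (p.1, truncate (p.2 - 1))

/-- The parameter of the interpolation between a given right inverse and the trivial one. -/
def interpolationParameter (a : X → ℝ) (x : X) : ℝ := max (-1) (min 2 (5 - 12 * a x))

/-- The homotopy that belongs to the interpolated right inverse. -/
def interpolatedHomotopy (y : X → James x₀) (γ K : X × I → James x₀) (a : X → ℝ) (p : X × I) :
    James x₀ :=
  let s := interpolationParameter a p.1
  let T := (p.2 : ℝ) * ((1 + min s 0) + 2 - |s|)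
  if T ≤ 1 + min s 0 then K (p.1, truncate T) * inversePath y γ K (p.1, max s 0)
  else inversePath y γ K (p.1, |s| + T - (1 + min s 0))

/-- The affine function `5 - 12 * a` is the one with value `-1` at `a = 1 / 2` and `2` at `a = 1 /
4`. -/
theorem interpolationParameter_of_le {x : X} (hx : 1 / 2 ≤ a x) :
    interpolationParameter a x = -1 :=
  max_eq_left ((min_le_right _ _).trans (by linarith))

theorem interpolationParameter_of_ge {x : X} (hx : a x ≤ 1 / 4) :
    interpolationParameter a x = 2 := by
  rw [interpolationParameter, min_eq_left (by linarith)]; norm_num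

theorem interpolationParameter_mem (x : X) :
    -1 ≤ interpolationParameter a x ∧ interpolationParameter a x ≤ 2 :=
  ⟨le_max_left _ _, max_le (by norm_num) (min_le_left _ _)⟩

theorem inversePath_of_mem {x : X} (hK1 : K (x, 1) = 1) : inversePath y γ K (x, 0) = y x := by
  simp [inversePath, hK1]

theorem inversePath_two {x : X} (h1 : γ (x, 1) = 1) : inversePath y γ K (x, 2) = 1 := by
  rw [inversePath, if_neg (by norm_num), truncate_of_one_le (by norm_num), h1]

theorem interpolatedHomotopy_of_le {x : X} (t : I) (hx : 1 / 2 ≤ a x) (hK0 : K (x, 0) = e x)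
    (hK1 : K (x, 1) = 1) (h0 : γ (x, 0) = e x * y x) :
    interpolatedHomotopy y γ K a (x, t) = γ (x, t) := by
  simp only [interpolatedHomotopy, interpolationParameter_of_le hx]
  norm_num
  by_cases ht : t = 0
  · subst ht
    simp [inversePath_of_mem hK1, hK0, h0]
  · have ht' : (0 : ℝ) < t := unitInterval.pos_iff_ne_zero.2 ht
    have ht2 : ¬ (t : ℝ) ≤ 0 := not_le.2 ht'
    have ht3 : ¬ 1 + (t : ℝ) ≤ 1 := by linarith
    rw [if_neg (by simpa using ht2), inversePath, if_neg ht3]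
    simp

theorem interpolatedHomotopy_of_ge {x : X} (t : I) (hx : a x ≤ 1 / 4) (h1 : γ (x, 1) = 1) :
    interpolatedHomotopy y γ K a (x, t) = K (x, t) := by
  simp only [interpolatedHomotopy, interpolationParameter_of_ge hx]
  norm_num
  rw [if_pos t.2.2, inversePath_two h1, mul_one]

theorem interpolatedHomotopy_zero {x : X} (hK0 : K (x, 0) = e x) :
    interpolatedHomotopy y γ K a (x, 0) =
      e x * inversePath y γ K (x, max (interpolationParameter a x) 0) := by
  have : 0 ≤ 1 + min (interpolationParameter a x) 0 := by
    have := (interpolationParameter_mem (a := a) x).1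
    rcases min_choice (interpolationParameter a x) 0 with h | h <;> rw [h] <;> linarith
  simp [interpolatedHomotopy, this, hK0]

theorem interpolatedHomotopy_one {x : X} (hK1 : K (x, 1) = 1) (h1 : γ (x, 1) = 1) :
    interpolatedHomotopy y γ K a (x, 1) = 1 := by
  obtain ⟨hl, hu⟩ := interpolationParameter_mem (a := a) x
  simp only [interpolatedHomotopy, Set.Icc.coe_one, one_mul]
  split_ifs with h
  -- The total duration exceeds that of the `K` phase by `2 - |s|`, so time `1` falls in that phase
  -- only for `s = 2`.
  · have hs : interpolationParameter a x = 2 := by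
      have : 2 ≤ |interpolationParameter a x| := by linarith
      rcases abs_cases (interpolationParameter a x) with ⟨h1, -⟩ | ⟨h1, -⟩ <;> linarith
    rw [hs, truncate_of_one_le (by norm_num), hK1, max_eq_left (by norm_num), inversePath_two h1,
      mul_one]
  · convert inversePath_two (y := y) (K := K) h1 using 3
    ring

variable [TopologicalSpace X] [CompactlyGeneratedSpace X]

theorem continuousOn_inversePath {V : Set X} (hV : IsOpen V) (hy : ContinuousOn y V)
    (hγ : ContinuousOn γ (V ×ˢ Set.univ)) (hK : ContinuousOn K (V ×ˢ Set.univ))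
    (hK0 : ∀ x ∈ V, K (x, 0) = e x) (h0 : ∀ x ∈ V, γ (x, 0) = e x * y x) :
    ContinuousOn (inversePath y γ K) (V ×ˢ Set.univ) := by
  have hA : ContinuousOn (fun p : X × ℝ => K (p.1, truncate (1 - p.2)) * y p.1)
      (V ×ˢ Set.univ) := by
    refine James.continuousOn_mul (hV.prod isOpen_univ) ?_ ?_
    · exact hK.comp (Continuous.continuousOn (by fun_prop)) fun p hp => ⟨hp.1, trivial⟩
    · exact hy.comp continuousOn_fst fun p hp => hp.1
  have hB : ContinuousOn (fun p : X × ℝ => γ (p.1, truncate (p.2 - 1))) (V ×ˢ Set.univ) :=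
    hγ.comp (Continuous.continuousOn (by fun_prop)) fun p hp => ⟨hp.1, trivial⟩
  refine ContinuousOn.if ?_ (hA.mono Set.inter_subset_left) (hB.mono Set.inter_subset_left)
  rintro ⟨x, r⟩ ⟨hx, hp⟩
  have hr : r = 1 := frontier_le_subset_eq continuous_snd continuous_const hp
  subst hr
  simp [hK0 x hx.1, h0 x hx.1]

theorem continuousOn_interpolatedHomotopy {V : Set X} (hV : IsOpen V) (ha : Continuous a)
    (hη : ContinuousOn (inversePath y γ K) (V ×ˢ Set.univ))
    (hK : ContinuousOn K (V ×ˢ Set.univ)) (hK1 : ∀ x ∈ V, K (x, 1) = 1) :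
    ContinuousOn (interpolatedHomotopy y γ K a) (V ×ˢ Set.univ) := by
  have hs : Continuous (interpolationParameter a) := by unfold interpolationParameter; fun_prop
  have hA : ContinuousOn (fun p : X × I =>
      K (p.1, truncate ((p.2 : ℝ) * ((1 + min (interpolationParameter a p.1) 0) + 2 -
        |interpolationParameter a p.1|))) *
      inversePath y γ K (p.1, max (interpolationParameter a p.1) 0)) (V ×ˢ Set.univ) := by
    refine James.continuousOn_mul (hV.prod isOpen_univ) ?_ ?_
    · exact hK.comp (Continuous.continuousOn (by fun_prop)) fun p hp => ⟨hp.1, trivial⟩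
    · exact hη.comp (Continuous.continuousOn (by fun_prop)) fun p hp => ⟨hp.1, trivial⟩
  have hB : ContinuousOn (fun p : X × I => inversePath y γ K
      (p.1, |interpolationParameter a p.1| + (p.2 : ℝ) * ((1 + min (interpolationParameter a p.1) 0)
        + 2 - |interpolationParameter a p.1|) - (1 + min (interpolationParameter a p.1) 0)))
      (V ×ˢ Set.univ) :=
    hη.comp (Continuous.continuousOn (by fun_prop)) fun p hp => ⟨hp.1, trivial⟩
  refine ContinuousOn.if ?_ (hA.mono Set.inter_subset_left) (hB.mono Set.inter_subset_left)
  rintro ⟨x, t⟩ ⟨hx, hp⟩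
  have hT : (t : ℝ) * ((1 + min (interpolationParameter a x) 0) + 2 -
      |interpolationParameter a x|) = 1 + min (interpolationParameter a x) 0 :=
    frontier_le_subset_eq (f := fun p : X × I => (p.2 : ℝ) *
      ((1 + min (interpolationParameter a p.1) 0) + 2 - |interpolationParameter a p.1|))
      (g := fun p : X × I => 1 + min (interpolationParameter a p.1) 0)
      (by fun_prop) (by fun_prop) hp
  dsimp only
  rw [hT, add_sub_cancel_right]
  obtain ⟨hl, -⟩ := interpolationParameter_mem (a := a) x
  rcases le_total 0 (interpolationParameter a x) with h | h
  · rw [min_eq_right h, add_zero, truncate_one, hK1 x hx.1, one_mul, max_eq_left h,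
      abs_of_nonneg h]
  · rw [min_eq_left h, max_eq_right h, inversePath_of_mem (hK1 x hx.1), abs_of_nonpos h,
      inversePath, if_pos (by dsimp only; linarith)]
    simp

/-- On the overlap, `y` with `γ` competes with the trivial inverse with `K`. `inversePath` joins `y
x` (parameter `0`) through `e x * y x` (parameter `1`) to the unit (parameter `2`). For `s` in `[0,
2]` the inverse is its point at `s`; the homotopy first uses `K` to remove the factor `e x`, then
follows the path to its end. At `s = 0` this makes a detour from `e x * y x` to `y x` and back. For
`s` in `[-1, 0]` the detour is cut short at time `1 + s`, leaving just `γ` at `s = -1`; at `s = 2`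
just `K` is left. -/
theorem IsRightInverseOn.extend (ha : Continuous a) (hw : Continuous w)
    (hs : IsRightInverseOn e {x | 0 < a x} y γ)
    (hK : ContinuousOn K ({x | 0 < w x} ×ˢ Set.univ)) (hK0 : ∀ x, 0 < w x → K (x, 0) = e x)
    (hK1 : ∀ x, 0 < w x → K (x, 1) = 1) :
    ∃ y' γ', IsRightInverseOn e ({x | 1 / 2 < a x} ∪ {x | 0 < w x}) y' γ' ∧
      ∀ x, 1 / 2 < a x → y' x = y x ∧ ∀ t, γ' (x, t) = γ (x, t) := by
  have hA : {x | 1 / 2 < a x} ⊆ {x | 0 < a x} := fun x (hx : 1 / 2 < a x) =>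
    lt_trans (by norm_num) hx
  have hP : IsOpen {x | 1 / 2 < a x} := isOpen_lt continuous_const ha
  have hW : IsOpen {x | 0 < w x} := isOpen_lt continuous_const hw
  have hQ : IsOpen ({x | 0 < a x} ∩ {x | 0 < w x}) := (isOpen_lt continuous_const ha).inter hW
  have hR : IsOpen ({x | a x < 1 / 4} ∩ {x | 0 < w x}) := (isOpen_lt ha continuous_const).inter hW
  have hcover : {x | 1 / 2 < a x} ∪ {x | 0 < w x} = {x | 1 / 2 < a x} ∪
      (({x | 0 < a x} ∩ {x | 0 < w x}) ∪ ({x | a x < 1 / 4} ∩ {x | 0 < w x})) := by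
    ext x
    simp only [Set.mem_union, Set.mem_inter_iff, Set.mem_ofPred_eq]
    constructor
    · rintro (h | h)
      · exact Or.inl h
      · rcases lt_or_ge 0 (a x) with h' | h'
        · exact Or.inr (Or.inl ⟨h', h⟩)
        · exact Or.inr (Or.inr ⟨by linarith, h⟩)
    · rintro (h | ⟨-, h⟩ | ⟨-, h⟩)
      · exact Or.inl h
      · exact Or.inr h
      · exact Or.inr h
  have hη := continuousOn_inversePath hQ (hs.continuousOn_fst.mono Set.inter_subset_left)
    (hs.continuousOn_snd.mono (Set.prod_mono Set.inter_subset_left le_rfl))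
    (hK.mono (Set.prod_mono Set.inter_subset_right le_rfl)) (fun x hx => hK0 x hx.2)
    (fun x hx => hs.zero x hx.1)
  have hB := continuousOn_interpolatedHomotopy hQ ha hη
    (hK.mono (Set.prod_mono Set.inter_subset_right le_rfl)) (fun x hx => hK1 x hx.2)
  have hpar : Continuous (interpolationParameter a) := by
    unfold interpolationParameter; fun_prop
  -- Nothing is known about `y` and `γ` where `a ≤ 0`, nor about `K` where `w ≤ 0`; the three cases
  -- avoid using either there.
  let y' : X → James x₀ := fun x => if 1 / 2 < a x then y x else
    if 0 < a x then inversePath y γ K (x, max (interpolationParameter a x) 0) else 1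
  let γ' : X × I → James x₀ := fun p => if 1 / 2 < a p.1 then γ p else
    if 0 < a p.1 then interpolatedHomotopy y γ K a p else K p
  have hyP : ∀ x, 1 / 2 < a x → y' x = y x := fun x hx => if_pos hx
  have hγP : ∀ x t, 1 / 2 < a x → γ' (x, t) = γ (x, t) := fun x t hx => if_pos hx
  have hyQ : ∀ x, 0 < a x → 0 < w x →
      y' x = inversePath y γ K (x, max (interpolationParameter a x) 0) := by
    intro x hx hwx
    by_cases h : 1 / 2 < a x
    · rw [hyP x h, interpolationParameter_of_le h.le, max_eq_right (by norm_num),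
        inversePath_of_mem (hK1 x hwx)]
    · simp only [y', if_neg h, if_pos hx]
  have hγQ : ∀ x t, 0 < a x → 0 < w x → γ' (x, t) = interpolatedHomotopy y γ K a (x, t) := by
    intro x t hx hwx
    by_cases h : 1 / 2 < a x
    · rw [hγP x t h, interpolatedHomotopy_of_le t h.le (hK0 x hwx) (hK1 x hwx) (hs.zero x hx)]
    · simp only [γ', if_neg h, if_pos hx]
  have hyR : ∀ x, a x < 1 / 4 → 0 < w x → y' x = 1 := by
    intro x hx hwx
    by_cases h : 0 < a x
    · rw [hyQ x h hwx, interpolationParameter_of_ge hx.le, max_eq_left (by norm_num),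
        inversePath_two (hs.one x h)]
    · have h' : ¬ 1 / 2 < a x := by linarith
      simp only [y', if_neg h, if_neg h']
  have hγR : ∀ x t, a x < 1 / 4 → 0 < w x → γ' (x, t) = K (x, t) := by
    intro x t hx hwx
    by_cases h : 0 < a x
    · rw [hγQ x t h hwx, interpolatedHomotopy_of_ge t hx.le (hs.one x h)]
    · have h' : ¬ 1 / 2 < a x := by linarith
      simp only [γ', if_neg h, if_neg h']
  refine ⟨y', γ', ⟨?_, ?_, ?_, ?_⟩, fun x hx => ⟨hyP x hx, fun t => hγP x t hx⟩⟩
  · rw [hcover]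
    refine ContinuousOn.union_of_isOpen ?_ (ContinuousOn.union_of_isOpen ?_ ?_ hQ hR) hP
      (hQ.union hR)
    · exact (hs.continuousOn_fst.mono hA).congr fun x hx => hyP x hx
    · refine ContinuousOn.congr (f := fun x =>
        inversePath y γ K (x, max (interpolationParameter a x) 0)) ?_ fun x hx => hyQ x hx.1 hx.2
      exact hη.comp (Continuous.continuousOn (by fun_prop)) fun x hx => ⟨hx, trivial⟩
    · exact continuousOn_const.congr fun x hx => hyR x hx.1 hx.2
  · rw [hcover, Set.union_prod, Set.union_prod]
    refine ContinuousOn.union_of_isOpen ?_ (ContinuousOn.union_of_isOpen ?_ ?_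
      (hQ.prod isOpen_univ) (hR.prod isOpen_univ)) (hP.prod isOpen_univ)
      ((hQ.prod isOpen_univ).union (hR.prod isOpen_univ))
    · exact (hs.continuousOn_snd.mono (Set.prod_mono hA le_rfl)).congr
        fun p hp => hγP p.1 p.2 hp.1
    · exact hB.congr fun p hp => hγQ p.1 p.2 hp.1.1 hp.1.2
    · exact (hK.mono (Set.prod_mono Set.inter_subset_right le_rfl)).congr
        fun p hp => hγR p.1 p.2 hp.1.1 hp.1.2
  · rw [hcover]
    rintro x (hx | ⟨hx, hwx⟩ | ⟨hx, hwx⟩)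
    · rw [hγP x _ hx, hyP x hx, hs.zero x (hA hx)]
    · rw [hγQ x _ hx hwx, hyQ x hx hwx, interpolatedHomotopy_zero (hK0 x hwx)]
    · rw [hγR x _ hx hwx, hyR x hx hwx, hK0 x hwx, mul_one]
  · rw [hcover]
    rintro x (hx | ⟨hx, hwx⟩ | ⟨hx, hwx⟩)
    · rw [hγP x _ hx, hs.one x (hA hx)]
    · rw [hγQ x _ hx hwx, interpolatedHomotopy_one (hK1 x hwx) (hs.one x hx)]
    · rw [hγR x _ hx hwx, hK1 x hwx]

end Extension

/-- The maximum of the first functions of a sequence. -/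
def runningMax {X : Type u} (w : ℕ → X → ℝ) : ℕ → X → ℝ
  | 0 => w 0
  | k + 1 => fun x => max (runningMax w k x) (w (k + 1) x)

theorem continuous_runningMax {X : Type u} [TopologicalSpace X] {w : ℕ → X → ℝ}
    (hw : ∀ i, Continuous (w i)) (k : ℕ) : Continuous (runningMax w k) := by
  induction k with
  | zero => exact hw 0
  | succ k ih => exact ih.max (hw (k + 1))

theorem le_runningMax {X : Type u} (w : ℕ → X → ℝ) (k : ℕ) (x : X) : w k x ≤ runningMax w k x := by
  cases k with
  | zero => exact le_rfl
  | succ k => exact le_max_right _ _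

theorem runningMax_mono {X : Type u} (w : ℕ → X → ℝ) (x : X) :
    Monotone fun k => runningMax w k x :=
  monotone_nat_of_le_succ fun _ => le_max_left _ _

/-- A map to `J(X)` that is null homotopic over the sets of a countable cozero cover has a right
homotopy inverse, which may be prescribed near a point. -/
theorem exists_rightInverse_of_cover {X : Type u} [TopologicalSpace X] [CompactlyGeneratedSpace X]
    {x₀ : X} {e : X → James x₀} {w : ℕ → X → ℝ} {K : ℕ → X × I → James x₀}
    (hw : ∀ i, Continuous (w i)) (hK : ∀ i, ContinuousOn (K i) ({x | 0 < w i x} ×ˢ Set.univ))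
    (hK0 : ∀ i x, 0 < w i x → K i (x, 0) = e x) (hK1 : ∀ i x, 0 < w i x → K i (x, 1) = 1)
    (hcov : ∀ x, ∃ i, 1 < w i x) :
    ∃ y γ, IsRightInverseOn e Set.univ y γ ∧
      ∀ x, 1 < w 0 x → y x = 1 ∧ ∀ t, γ (x, t) = K 0 (x, t) := by
  let M := runningMax w
  -- Stage `k` lives on `{b k < M k}`, and the next stage preserves it only on the smaller set `{b
  -- (k + 1) < M k}`. Since the thresholds stay at most `1`, the data on `{1 < M k}` never change
  -- after stage `k`.
  let b : ℕ → ℝ := fun k => 1 - (1 / 2) ^ k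
  have hb : ∀ k, b k < b (k + 1) := fun k => by
    have : (0 : ℝ) < (1 / 2) ^ k := by positivity
    simp only [b, pow_succ]; linarith
  have hb0 : ∀ k, 0 ≤ b k := fun k => by
    have : (1 / 2 : ℝ) ^ k ≤ 1 := pow_le_one₀ (by norm_num) (by norm_num)
    simp only [b]; linarith
  have hb1 : ∀ k, b k ≤ 1 := fun k => by
    have : (0 : ℝ) < (1 / 2) ^ k := by positivity
    simp only [b]; linarith
  let S : ℕ → Type u := fun k => {s : (X → James x₀) × (X × I → James x₀) //
    IsRightInverseOn e {x | b k < M k x} s.1 s.2}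
  have hstep : ∀ k (s : S k), ∃ s' : S (k + 1), ∀ x, b (k + 1) < M k x →
      s'.1.1 x = s.1.1 x ∧ ∀ t, s'.1.2 (x, t) = s.1.2 (x, t) := by
    rintro k ⟨⟨y, γ⟩, hs⟩
    have hd : 0 < b (k + 1) - b k := sub_pos.2 (hb k)
    -- Normalised so that `M k = b k` and `M k = b (k + 1)` correspond to `a = 0` and `a = 1 / 2`.
    let a : X → ℝ := fun x => (M k x - b k) / (2 * (b (k + 1) - b k))
    have ha : Continuous a := ((continuous_runningMax hw k).sub continuous_const).div_const _
    have ha0 : ∀ x, 0 < a x ↔ b k < M k x := fun x => by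
      rw [div_pos_iff_of_pos_right (by linarith), sub_pos]
    have ha1 : ∀ x, 1 / 2 < a x ↔ b (k + 1) < M k x := fun x => by
      rw [lt_div_iff₀ (by linarith)]
      constructor <;> intro h <;> linarith
    have hs' : IsRightInverseOn e {x | 0 < a x} y γ := by simpa only [ha0] using hs
    obtain ⟨y', γ', h, heq⟩ := hs'.extend ha (hw (k + 1)) (hK (k + 1)) (hK0 (k + 1)) (hK1 (k + 1))
    have hsub : {x | b (k + 1) < M (k + 1) x} ⊆ {x | 1 / 2 < a x} ∪ {x | 0 < w (k + 1) x} := by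
      intro x hx
      rcases lt_max_iff.1 (show b (k + 1) < max (M k x) (w (k + 1) x) from hx) with h | h
      · exact Or.inl ((ha1 x).2 h)
      · exact Or.inr ((hb0 _).trans_lt h)
    exact ⟨⟨⟨y', γ'⟩, h.continuousOn_fst.mono hsub,
      h.continuousOn_snd.mono (Set.prod_mono hsub le_rfl), fun x hx => h.zero x (hsub hx),
      fun x hx => h.one x (hsub hx)⟩, fun x hx => heq x ((ha1 x).2 hx)⟩
  choose F hF using hstep
  have h0 : IsRightInverseOn e {x | b 0 < M 0 x} (fun _ => 1) (K 0) := by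
    have : {x | b 0 < M 0 x} = {x | 0 < w 0 x} := by simp [b, M, runningMax]
    rw [this]
    exact ⟨continuousOn_const, hK 0, fun x hx => by rw [hK0 0 x hx, mul_one], hK1 0⟩
  let s : ∀ k, S k := fun k => Nat.rec ⟨(fun _ => 1, K 0), h0⟩ F k
  have hmono : ∀ x j k, j ≤ k → 1 < M j x →
      (s k).1.1 x = (s j).1.1 x ∧ ∀ t, (s k).1.2 (x, t) = (s j).1.2 (x, t) := by
    intro x j k hjk hj
    induction k, hjk using Nat.le_induction with
    | base => exact ⟨rfl, fun _ => rfl⟩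
    | succ k hjk ih =>
      have h := hF k (s k) x
        (((hb1 _).trans_lt hj).trans_le (runningMax_mono w x hjk))
      exact ⟨h.1.trans ih.1, fun t => (h.2 t).trans (ih.2 t)⟩
  have hcov' : ∀ x, ∃ k, 1 < M k x := fun x =>
    (hcov x).imp fun i hi => hi.trans_le (le_runningMax w i x)
  choose κ hκ using hcov'
  have hlim : ∀ x k, 1 < M k x → (s (κ x)).1.1 x = (s k).1.1 x ∧
      ∀ t, (s (κ x)).1.2 (x, t) = (s k).1.2 (x, t) := by
    intro x k hk
    rcases le_total k (κ x) with h | h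
    · exact hmono x k _ h hk
    · exact ⟨(hmono x _ _ h (hκ x)).1.symm, fun t => ((hmono x _ _ h (hκ x)).2 t).symm⟩
  have hopen : ∀ k, IsOpen {x | 1 < M k x} := fun k =>
    isOpen_lt continuous_const (continuous_runningMax hw k)
  have hsub : ∀ k, {x | 1 < M k x} ⊆ {x | b k < M k x} := fun k x hx => (hb1 k).trans_lt hx
  refine ⟨fun x => (s (κ x)).1.1 x, fun p => (s (κ p.1)).1.2 p, ⟨?_, ?_, ?_, ?_⟩, ?_⟩
  · intro x _
    have hc : ContinuousOn (fun x => (s (κ x)).1.1 x) {x' | 1 < M (κ x) x'} :=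
      ((s (κ x)).2.continuousOn_fst.mono (hsub _)).congr fun x' hx' => (hlim x' _ hx').1
    exact (hc.continuousAt ((hopen _).mem_nhds (hκ x))).continuousWithinAt
  · rintro ⟨x, t⟩ _
    have hc : ContinuousOn (fun p : X × I => (s (κ p.1)).1.2 p)
        ({x' | 1 < M (κ x) x'} ×ˢ Set.univ) :=
      ((s (κ x)).2.continuousOn_snd.mono (Set.prod_mono (hsub _) le_rfl)).congr
        fun p hp => (hlim p.1 _ hp.1).2 p.2
    exact (hc.continuousAt (((hopen _).prod isOpen_univ).mem_nhds
      (show (x, t) ∈ {x' | 1 < M (κ x) x'} ×ˢ Set.univ from ⟨hκ x, trivial⟩))).continuousWithinAt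
  · exact fun x _ => (s (κ x)).2.zero x (hsub _ (hκ x))
  · exact fun x _ => (s (κ x)).2.one x (hsub _ (hκ x))
  · exact fun x hx => hlim x 0 hx

/-- The inclusion `E : X → J(X)` has a pointed right homotopy inverse. -/
theorem James.exists_rightInverse_E {X : Type u} [TopologicalSpace X] [CompactlyGeneratedSpace X]
    {x₀ : X} (c : Collar x₀) (hcat : WeakLSCategoryLT x₀ 2) :
    ∃ (y : X → James x₀) (γ : X × I → James x₀), Continuous y ∧ Continuous γ ∧
      (∀ x, γ (x, 0) = James.E x₀ x * y x) ∧ (∀ x, γ (x, 1) = 1) ∧ y x₀ = 1 ∧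
      ∀ t, γ (x₀, t) = 1 := by
  obtain ⟨u, K, hu, hK, hK01, hcov⟩ := hcat.exists_contractible_cover c
  obtain ⟨e, he⟩ := exists_surjective_nat (ℕ × ℕ)
  -- The collar comes first, so near the basepoint the glued inverse is `1` and its homotopy is the
  -- collar's, which makes both pointed. All multiples `n * u i` occur because covering means `1 <
  -- w`, not just `0 < w`.
  let w : ℕ → X → ℝ := fun i => i.rec (fun x => 2 * (1 - c.v x))
    fun j _ x => (e j).2 * u (e j).1 x
  let K' : ℕ → X × I → X := fun i => i.rec c.h fun j _ => K (e j).1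
  have hpos : ∀ j x, 0 < w (j + 1) x → 0 < u (e j).1 x := fun j x hx =>
    pos_of_mul_pos_right hx (Nat.cast_nonneg _)
  have hK' : ∀ i x, 0 < w i x → K' i (x, 0) = x ∧ K' i (x, 1) = x₀ := by
    rintro (_ | j) x hx
    · refine ⟨c.h_zero x, c.h_one x ?_⟩
      have : 0 < 2 * (1 - c.v x) := hx
      linarith
    · exact hK01 _ x (hpos j x hx)
  have hw : ∀ i, Continuous (w i) := by
    rintro (_ | j)
    · change Continuous fun x => 2 * (1 - c.v x)
      fun_prop
    · exact continuous_const.mul (hu _)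
  have hKc : ∀ i, ContinuousOn (fun p => James.E x₀ (K' i p)) ({x | 0 < w i x} ×ˢ Set.univ) := by
    rintro (_ | j)
    · exact ((James.E x₀).continuous.comp c.continuous_h).continuousOn
    · exact (James.E x₀).continuous.comp_continuousOn
        ((hK _).mono (Set.prod_mono (fun x hx => hpos j x hx) le_rfl))
  have hcov' : ∀ x, ∃ i, 1 < w i x := by
    intro x
    rcases lt_or_ge (c.v x) (1 / 2) with hx | hx
    · exact ⟨0, show 1 < 2 * (1 - c.v x) by linarith⟩
    · obtain ⟨i, hi⟩ := hcov x (by linarith)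
      obtain ⟨n, hn⟩ := exists_nat_gt (1 / u i x)
      obtain ⟨j, hj⟩ := he (i, n)
      refine ⟨j + 1, ?_⟩
      change 1 < ((e j).2 : ℝ) * u (e j).1 x
      rw [hj]
      rwa [div_lt_iff₀ hi] at hn
  obtain ⟨y, γ, h, hb⟩ := exists_rightInverse_of_cover (e := James.E x₀) hw hKc
    (fun i x hx => by rw [(hK' i x hx).1])
    (fun i x hx => by rw [(hK' i x hx).2, James.E_base]) hcov'
  refine ⟨y, γ, continuousOn_univ.1 h.continuousOn_fst, ?_, fun x => h.zero x trivial,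
    fun x => h.one x trivial, ?_⟩
  · have := h.continuousOn_snd
    rwa [Set.univ_prod_univ, continuousOn_univ] at this
  · have h1 : 1 < w 0 x₀ := by
      change 1 < 2 * (1 - c.v x₀)
      rw [c.v_base]; norm_num
    refine ⟨(hb x₀ h1).1, fun t => ?_⟩
    rw [(hb x₀ h1).2 t]
    change James.E x₀ (c.h (x₀, t)) = 1
    rw [c.h_base, James.E_base]

/-! ### The homotopy inverse on the James construction -/

namespace James

variable {X : Type u} {x₀ : X}

/-- The point of `J(X)` represented by a list of points of `X`. -/
def ofList (x₀ : X) (l : List X) : James x₀ :=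
  PresentedMonoid.mk (jamesRel x₀) (FreeMonoid.ofList l)

/-- The monoid homomorphism on `J(X)` extending a map that sends the basepoint to the unit. -/
def lift {M : Type*} [Monoid M] (f : X → M) (hf : f x₀ = 1) : James x₀ →* M :=
  PresentedMonoid.lift f (by
    rintro a b ⟨rfl, rfl⟩
    rw [FreeMonoid.lift_eval_of, hf, map_one])

theorem lift_ofList_nil {M : Type*} [Monoid M] (f : X → M) (hf : f x₀ = 1) :
    lift f hf (ofList x₀ []) = 1 :=
  map_one (lift f hf)

theorem lift_ofList_cons {M : Type*} [Monoid M] (f : X → M) (hf : f x₀ = 1) (x : X) (l : List X) :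
    lift f hf (ofList x₀ (x :: l)) = f x * lift f hf (ofList x₀ l) :=
  map_mul (lift f hf) (PresentedMonoid.of (jamesRel x₀) x) (ofList x₀ l)

theorem ofList_surjective (w : James x₀) : ∃ l, ofList x₀ l = w := by
  obtain ⟨w, rfl⟩ := PresentedMonoid.surjective_mk (rels := jamesRel x₀) w
  exact ⟨w.toList, rfl⟩

variable [TopologicalSpace X]

/-- A map on `J(X) × W` is continuous if it is so on words with continuously varying letters. -/
theorem continuous_of_lists {W : Type} [TopologicalSpace W] [LocallyCompactSpace W] {Y : Type*}
    [TopologicalSpace Y] {F : James x₀ × W → Y}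
    (hF : ∀ {Z : Type u} [TopologicalSpace Z] [CompactlyGeneratedSpace Z] (L : List C(Z, X)),
      Continuous fun p : Z × W => F (ofList x₀ (L.map fun f => f p.1), p.2)) : Continuous F := by
  refine (James.isQuotientMap_word x₀).continuous_lift_prod_left ?_
  rw [← Homeomorph.sigmaProdDistrib.symm.comp_continuous_iff']
  refine continuous_sigma fun k => ?_
  refine (hF (List.ofFn fun i : Fin k =>
    (⟨fun x => x.coord i, KPow.continuous_coord i⟩ : C(KPow X k, X)))).congr fun p => ?_
  rw [List.map_ofFn]
  rfl

variable [CompactlyGeneratedSpace X]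

theorem E_mul_ofList (x : X) (l : List X) : E x₀ x * ofList x₀ l = ofList x₀ (x :: l) :=
  (map_mul (PresentedMonoid.mk (jamesRel x₀)) (FreeMonoid.of x) (FreeMonoid.ofList l)).symm

end James

/-- A null homotopy of the pointwise product of `g` and `k` in which the point `x` reaches the unit
at time `τ x`. -/
structure MooreNullHomotopy {X : Type u} [TopologicalSpace X] (x₀ : X) (g : X → James x₀) where
  k : X → James x₀
  τ : X → ℝ
  Δ : X × ℝ → James x₀
  continuous_k : Continuous k
  continuous_τ : Continuous τ
  continuous_Δ : Continuous Δ
  base : g x₀ = 1 ∧ k x₀ = 1 ∧ τ x₀ = 0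
  τ_nonneg : ∀ x, 0 ≤ τ x
  Δ_zero : ∀ x, Δ (x, 0) = g x * k x
  Δ_of_le : ∀ x t, τ x ≤ t → Δ (x, t) = 1

/-- A point of `J(X)` with a Moore path ending at the unit. -/
@[ext]
structure MooreState {X : Type u} [TopologicalSpace X] (x₀ : X) where
  b : James x₀
  T : ℝ
  δ : ℝ → James x₀
  T_nonneg : 0 ≤ T
  δ_of_le : ∀ t, T ≤ t → δ t = 1

namespace MooreNullHomotopy

variable {X : Type u} [TopologicalSpace X] {x₀ : X} {g : X → James x₀}
  (N : MooreNullHomotopy x₀ g)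

/-- Conjugating a path by a letter and then following the null homotopy of the letter. -/
def act (x : X) : Function.End (MooreState x₀) := fun s =>
  { b := s.b * N.k x
    T := s.T + N.τ x
    δ := fun t => if t ≤ s.T then g x * s.δ t * N.k x else N.Δ (x, t - s.T)
    T_nonneg := add_nonneg s.T_nonneg (N.τ_nonneg x)
    δ_of_le := fun t ht => by
      have h0 := N.τ_nonneg x
      split_ifs with h
      · rw [s.δ_of_le t (by linarith), mul_one, ← N.Δ_zero, N.Δ_of_le x 0 (by linarith)]
      · exact N.Δ_of_le x _ (by linarith) }

/-- The basepoint letter takes time `0`, so inserting it changes nothing, not even the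
parametrisation. Moore paths of variable length are used for this reason: the action descends from
words to `J(X)`. -/
theorem act_base : N.act x₀ = 1 := by
  obtain ⟨hg, hk, hτ⟩ := N.base
  funext s
  refine MooreState.ext ?_ ?_ ?_
  · exact (congrArg (s.b * ·) hk).trans (mul_one _)
  · exact (congrArg (s.T + ·) hτ).trans (add_zero _)
  · funext t
    change (if t ≤ s.T then g x₀ * s.δ t * N.k x₀ else N.Δ (x₀, t - s.T)) = s.δ t
    split_ifs with h
    · rw [hg, hk, one_mul, mul_one]
    · rw [N.Δ_of_le x₀ _ (by linarith), s.δ_of_le t (by linarith)]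

/-- The state associated with a point of `J(X)`. -/
def state (w : James x₀) : MooreState x₀ :=
  James.lift N.act N.act_base w ⟨1, 0, fun _ => 1, le_rfl, fun _ _ => rfl⟩

theorem state_nil :
    N.state (James.ofList x₀ []) = ⟨1, 0, fun _ => 1, le_rfl, fun _ _ => rfl⟩ := by
  rw [state, James.lift_ofList_nil]; rfl

theorem state_cons (x : X) (l : List X) :
    N.state (James.ofList x₀ (x :: l)) = N.act x (N.state (James.ofList x₀ l)) := by
  rw [state, James.lift_ofList_cons]; rfl

/-- A new letter multiplies `b` on the right and the product of `g`-values on the left, so the path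
starts at `g x₁ ⋯ g xₖ * k xₖ ⋯ k x₁` and cancels the innermost pair first. -/
theorem state_δ_zero (w : James x₀) :
    (N.state w).δ 0 = James.lift g N.base.1 w * (N.state w).b := by
  obtain ⟨l, rfl⟩ := James.ofList_surjective w
  induction l with
  | nil => rw [state_nil, James.lift_ofList_nil, one_mul]
  | cons x l ih =>
    rw [state_cons, James.lift_ofList_cons]
    change (if _ then _ else _) = _ * (_ * _)
    rw [if_pos (N.state _).T_nonneg, ih]
    simp only [mul_assoc]

theorem continuous_state_lists (hg : Continuous g) {Z : Type u} [TopologicalSpace Z]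
    [CompactlyGeneratedSpace Z] (L : List C(Z, X)) :
    (Continuous fun z => (N.state (James.ofList x₀ (L.map fun f => f z))).b) ∧
    (Continuous fun z => (N.state (James.ofList x₀ (L.map fun f => f z))).T) ∧
    Continuous fun p : Z × ℝ => (N.state (James.ofList x₀ (L.map fun f => f p.1))).δ p.2 := by
  induction L with
  | nil =>
    simp only [List.map_nil, state_nil]
    exact ⟨continuous_const, continuous_const, continuous_const⟩
  | cons f L ih =>
    obtain ⟨hb, hT, hδ⟩ := ih
    simp only [List.map_cons, state_cons]
    refine ⟨James.continuous_mul x₀ hb (N.continuous_k.comp f.continuous),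
      hT.add (N.continuous_τ.comp f.continuous), ?_⟩
    refine Continuous.if_le ?_ ?_ continuous_snd (hT.comp continuous_fst) ?_
    · exact James.continuous_mul x₀ (James.continuous_mul x₀
        (hg.comp (f.continuous.comp continuous_fst)) hδ)
        (N.continuous_k.comp (f.continuous.comp continuous_fst))
    · exact N.continuous_Δ.comp ((f.continuous.comp continuous_fst).prodMk
        (continuous_snd.sub (hT.comp continuous_fst)))
    · rintro ⟨z, t⟩ h
      dsimp only at h ⊢
      rw [h, (N.state _).δ_of_le _ le_rfl, mul_one, sub_self, N.Δ_zero]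

theorem continuous_state_b (hg : Continuous g) : Continuous fun w => (N.state w).b := by
  have : Continuous fun p : James x₀ × Unit => (N.state p.1).b :=
    James.continuous_of_lists fun L => (N.continuous_state_lists hg L).1.comp continuous_fst
  exact this.comp (continuous_id.prodMk continuous_const : Continuous fun w => (w, ()))

theorem continuous_state_δ (hg : Continuous g) :
    Continuous fun p : James x₀ × ℝ => (N.state p.1).δ (p.2 * (N.state p.1).T) := by
  refine James.continuous_of_lists fun L => ?_
  obtain ⟨-, hT, hδ⟩ := N.continuous_state_lists hg L
  exact hδ.comp (continuous_fst.prodMk (continuous_snd.mul (hT.comp continuous_fst)))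

theorem state_one : N.state 1 = ⟨1, 0, fun _ => 1, le_rfl, fun _ _ => rfl⟩ :=
  N.state_nil

end MooreNullHomotopy

/-! ### Homotopy inverses on `J(X)` and invertibility of classes -/

section Inverse

variable {X : Type u} [TopologicalSpace X] [CompactlyGeneratedSpace X] {x₀ : X}

/-- The extension of the deformation of a collar to `J(X)`. -/
def Collar.jamesMap (c : Collar x₀) (t : I) : James x₀ →* James x₀ :=
  James.lift (fun x => James.E x₀ (c.h (x, t))) (by rw [c.h_base, James.E_base])

theorem Collar.continuous_jamesMap (c : Collar x₀) :
    Continuous fun p : James x₀ × I => c.jamesMap p.2 p.1 := by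
  refine James.continuous_of_lists fun L => ?_
  induction L with
  | nil =>
    simp only [List.map_nil, jamesMap, James.lift_ofList_nil]
    exact continuous_const
  | cons f L ih =>
    simp only [List.map_cons, jamesMap, James.lift_ofList_cons]
    exact James.continuous_mul x₀ (by fun_prop) ih

theorem Collar.continuous_jamesMap_apply (c : Collar x₀) {Z : Type*} [TopologicalSpace Z]
    {a : Z → James x₀} {t : Z → I} (ha : Continuous a) (ht : Continuous t) :
    Continuous fun z => c.jamesMap (t z) (a z) :=
  c.continuous_jamesMap.comp (ha.prodMk ht)

theorem Collar.jamesMap_zero (c : Collar x₀) (w : James x₀) : c.jamesMap 0 w = w := by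
  obtain ⟨l, rfl⟩ := James.ofList_surjective w
  induction l with
  | nil => exact map_one _
  | cons x l ih =>
    rw [jamesMap, James.lift_ofList_cons, c.h_zero, ← James.E_mul_ofList]
    exact congrArg _ ih

/-- Precomposition with the end of the collar deformation turns a pointed null homotopy into a
Moore null homotopy. -/
def Collar.mooreNullHomotopy (c : Collar x₀) {y : X → James x₀} {γ : X × I → James x₀}
    (hy : Continuous y) (hγ : Continuous γ) (h0 : ∀ x, γ (x, 0) = James.E x₀ x * y x)
    (h1 : ∀ x, γ (x, 1) = 1) (hyb : y x₀ = 1) (hγb : ∀ t, γ (x₀, t) = 1) :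
    MooreNullHomotopy x₀ fun x => James.E x₀ (c.h (x, 1)) where
  k x := y (c.h (x, 1))
  -- The duration vanishes exactly for `v ≤ 1 / 2`. There `c.h (x, 1)` is the basepoint, where `γ`
  -- is constantly `1`, so the division by zero in `Δ` is harmless; on `1 / 2 < v < 1` both
  -- descriptions of `Δ` agree.
  τ x := max 0 (2 * c.v x - 1)
  Δ p := γ (c.h (p.1, 1), truncate (p.2 / max 0 (2 * c.v p.1 - 1)))
  continuous_k := by fun_prop
  continuous_τ := by fun_prop
  continuous_Δ := by
    have h2 : IsOpen {p : X × ℝ | 1 / 2 < c.v p.1} := isOpen_lt (by fun_prop) (by fun_prop)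
    have h3 : IsOpen {p : X × ℝ | c.v p.1 < 1} := isOpen_lt (by fun_prop) (by fun_prop)
    rw [← continuousOn_univ, show (Set.univ : Set (X × ℝ)) =
      {p | 1 / 2 < c.v p.1} ∪ {p | c.v p.1 < 1} from ?_]
    · refine ContinuousOn.union_of_isOpen ?_ ?_ h2 h3
      · refine hγ.comp_continuousOn (ContinuousOn.prodMk (by fun_prop)
          (continuous_truncate.comp_continuousOn (ContinuousOn.div (by fun_prop) (by fun_prop) ?_)))
        intro p hp
        have : 1 / 2 < c.v p.1 := hp
        exact (lt_max_of_lt_right (by linarith)).ne'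
      · refine (continuousOn_const (c := (1 : James x₀))).congr fun p hp => ?_
        dsimp only
        rw [c.h_one _ hp, hγb]
    · refine (Set.eq_univ_of_forall fun p => ?_).symm
      rcases lt_or_ge (c.v p.1) 1 with h | h
      · exact Or.inr h
      · exact Or.inl (lt_of_lt_of_le (by norm_num) h)
  base := by
    refine ⟨?_, ?_, ?_⟩
    · rw [c.h_base, James.E_base]
    · rw [c.h_base, hyb]
    · rw [c.v_base]; norm_num
  τ_nonneg x := le_max_left _ _
  Δ_zero x := by rw [zero_div, truncate_zero, h0]
  Δ_of_le x t ht := by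
    rcases le_or_gt (c.v x) (1 / 2) with h | h
    · rw [c.h_one _ (by linarith), hγb]
    · have : 0 < max 0 (2 * c.v x - 1) := lt_max_of_lt_right (by linarith)
      rw [truncate_of_one_le ((one_le_div this).2 ht), h1]

/-- `J(X)` has a pointed right homotopy inverse. -/
theorem James.exists_homotopyInverse (c : Collar x₀) (hcat : WeakLSCategoryLT x₀ 2) :
    ∃ (χ : James x₀ → James x₀) (D : James x₀ × I → James x₀), Continuous χ ∧ Continuous D ∧
      (∀ w, D (w, 0) = w * χ w) ∧ (∀ w, D (w, 1) = 1) ∧ χ 1 = 1 ∧ ∀ t, D (1, t) = 1 := by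
  obtain ⟨y, γ, hy, hγ, h0, h1, hyb, hγb⟩ := James.exists_rightInverse_E c hcat
  obtain ⟨N⟩ : Nonempty (MooreNullHomotopy x₀ fun x => James.E x₀ (c.h (x, 1))) :=
    ⟨c.mooreNullHomotopy hy hγ h0 h1 hyb hγb⟩
  have hg : Continuous fun x => James.E x₀ (c.h (x, 1)) := by fun_prop
  have hb := N.continuous_state_b hg
  have hA : Continuous fun p : James x₀ × I =>
      c.jamesMap (truncate (2 * p.2)) p.1 * (N.state p.1).b := by
    exact James.continuous_mul x₀ (c.continuous_jamesMap_apply continuous_fst (by fun_prop))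
      (hb.comp continuous_fst)
  have hB : Continuous fun p : James x₀ × I =>
      (N.state p.1).δ ((2 * p.2 - 1) * (N.state p.1).T) := by
    have h2 : Continuous fun p : James x₀ × I => (p.1, 2 * (p.2 : ℝ) - 1) := by fun_prop
    exact (N.continuous_state_δ hg).comp h2
  -- The first half deforms the factor `w` along the collar to the product of the `g`-values of its
  -- letters; the second half runs the Moore path, rescaled by its length.
  refine ⟨fun w => (N.state w).b, fun p => if (p.2 : ℝ) ≤ 1 / 2 then
    c.jamesMap (truncate (2 * p.2)) p.1 * (N.state p.1).b else
    (N.state p.1).δ ((2 * p.2 - 1) * (N.state p.1).T), hb, ?_, fun w => ?_, fun w => ?_, ?_,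
    fun t => ?_⟩
  · refine Continuous.if_le hA hB (by fun_prop) (by fun_prop) ?_
    · rintro ⟨w, t⟩ h
      dsimp only at h ⊢
      rw [h, truncate_of_one_le (by norm_num), show (2 * (1 / 2) - 1 : ℝ) = 0 by norm_num, zero_mul,
        N.state_δ_zero]
      rfl
  · simp [c.jamesMap_zero]
  · dsimp only
    rw [if_neg (by norm_num)]
    exact (N.state w).δ_of_le _ (by norm_num)
  · dsimp only
    rw [N.state_one]
  · dsimp only
    rw [N.state_one, map_one, one_mul, ite_self]

theorem HomotopyClass.exists_mul_eq_one (c : Collar x₀) (hcat : WeakLSCategoryLT x₀ 2)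
    {Z : Type u} [TopologicalSpace Z] [CompactlyGeneratedSpace Z] {z₀ : Z}
    (a : HomotopyClass z₀ x₀) : ∃ b, a * b = 1 := by
  obtain ⟨χ, D, hχ, hD, hD0, hD1, hχb, hDb⟩ := James.exists_homotopyInverse c hcat
  obtain ⟨f, rfl⟩ := mk_surjective a
  let k : PointedMap z₀ x₀ := ⟨⟨fun z => χ (f.1 z), hχ.comp f.1.continuous⟩, by
    change χ (f.1 z₀) = 1
    rw [f.2, hχb]⟩
  refine ⟨mk k, ?_⟩
  rw [← mk_mul, ← mk_one]
  refine mk_eq_of_homotopy (fun p => D (f.1 p.1, p.2)) (by fun_prop) (fun z => hD0 _)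
    (fun z => hD1 _) fun t => ?_
  rw [f.2, hDb]

theorem HomotopyClass.isUnit (c : Collar x₀) (hcat : WeakLSCategoryLT x₀ 2)
    {Z : Type u} [TopologicalSpace Z] [CompactlyGeneratedSpace Z] {z₀ : Z}
    (a : HomotopyClass z₀ x₀) : IsUnit a := by
  obtain ⟨b, hab⟩ := exists_mul_eq_one c hcat a
  obtain ⟨d, hbd⟩ := exists_mul_eq_one c hcat b
  have : a = d := by rw [← mul_one a, ← hbd, ← mul_assoc, hab, one_mul]
  exact ⟨⟨a, b, hab, this ▸ hbd⟩, rfl⟩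

end Inverse

/-! ### Classes that are trivial on a coordinate hyperplane -/

namespace KPow

variable {X : Type u} [TopologicalSpace X] {n : ℕ}

/-- Replacing the `i`-th coordinate. -/
def update (z : KPow X n) (i : Fin n) (x : X) : KPow X n := mk (Function.update z.coord i x)

theorem coord_update (z : KPow X n) (i : Fin n) (x : X) : (z.update i x).coord i = x :=
  Function.update_self (β := fun _ => X) i x z.coord

theorem update_coord (z : KPow X n) (i : Fin n) : z.update i (z.coord i) = z :=
  congrArg mk (Function.update_eq_self i z.coord)

theorem update_base (x₀ : X) (i : Fin n) :
    (mk fun _ => x₀ : KPow X n).update i x₀ = mk fun _ => x₀ :=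
  update_coord (mk fun _ => x₀) i

theorem continuous_update {T : Type u} [TopologicalSpace T] [CompactlyGeneratedSpace T]
    {z : T → KPow X n} {x : T → X} (hz : Continuous z) (i : Fin n) (hx : Continuous x) :
    Continuous fun t => (z t).update i (x t) :=
  continuous_mk ((WithGeneratedByTopology.continuous_equiv.comp hz).update i hx)

end KPow

section Restriction

variable {X : Type u} [TopologicalSpace X] {x₀ : X} {n : ℕ}

/-- Restriction of a pointed map to the hyperplane where the `i`-th coordinate is the
basepoint. -/
def PointedMap.restrict (i : Fin n) (f : PointedMap (Z := KPow X n) (KPow.mk fun _ => x₀) x₀) :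
    PointedMap (Z := KPow X n) (KPow.mk fun _ => x₀) x₀ :=
  ⟨f.1.comp ⟨fun z => z.update i x₀, KPow.continuous_update continuous_id i continuous_const⟩, by
    change f.1 ((KPow.mk fun _ => x₀ : KPow X n).update i x₀) = 1
    rw [KPow.update_base, f.2]⟩

theorem PointedMap.restrict_apply (i : Fin n)
    (f : PointedMap (Z := KPow X n) (KPow.mk fun _ => x₀) x₀) (z : KPow X n) :
    (f.restrict i).1 z = f.1 (z.update i x₀) := rfl

/-- Restriction of classes to the hyperplane where the `i`-th coordinate is the basepoint. -/
def PowerClass.restrict (x₀ : X) (i : Fin n) : PowerClass x₀ n →* PowerClass x₀ n where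
  toFun := Quotient.lift (fun f => HomotopyClass.mk (PointedMap.restrict i f)) fun f g hfg => by
    obtain ⟨H, hH, h0, h1, hb⟩ := HomotopyClass.exists_homotopy (Quotient.sound hfg)
    refine HomotopyClass.mk_eq_of_homotopy (fun p => H (p.1.update i x₀, p.2)) ?_
      (fun z => h0 _) (fun z => h1 _) fun t => ?_
    · exact hH.comp ((KPow.continuous_update continuous_fst i continuous_const).prodMk
        continuous_snd)
    · rw [KPow.update_base, hb]
  map_one' := rfl
  map_mul' := by
    rintro ⟨f⟩ ⟨g⟩
    rfl

theorem PowerClass.restrict_mk (i : Fin n)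
    (f : PointedMap (Z := KPow X n) (KPow.mk fun _ => x₀) x₀) :
    restrict x₀ i (HomotopyClass.mk f) = HomotopyClass.mk (f.restrict i) := rfl

theorem PowerClass.restrict_coordinateClass [CompactlyGeneratedSpace X] (i : Fin n) :
    restrict x₀ i (coordinateClass x₀ i) = 1 := by
  refine congrArg HomotopyClass.mk (a₂ := 1) (Subtype.ext (ContinuousMap.ext fun z => ?_))
  change James.E x₀ ((z.update i x₀).coord i) = 1
  rw [KPow.coord_update, James.E_base]

/-- A class that is trivial on the hyperplane `zᵢ = *` is represented by a map that is trivial on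
a neighbourhood of this hyperplane. -/
theorem PowerClass.exists_rep_of_restrict_eq_one (c : Collar x₀) {i : Fin n} {a : PowerClass x₀ n}
    (ha : restrict x₀ i a = 1) :
    ∃ f, HomotopyClass.mk f = a ∧ ∀ z, c.v (z.coord i) ≤ 1 / 2 → f.1 z = 1 := by
  obtain ⟨f, rfl⟩ := HomotopyClass.mk_surjective a
  rw [restrict_mk, ← HomotopyClass.mk_one] at ha
  obtain ⟨N, hN, hN0, hN1, hNb⟩ := HomotopyClass.exists_homotopy ha
  have hv : Continuous fun z : KPow X n => c.v (z.coord i) :=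
    c.continuous_v.comp (KPow.continuous_coord i)
  have hH : Continuous fun p : KPow X n × I => f.1 (p.1.update i (c.h (p.1.coord i, p.2))) :=
    f.1.continuous.comp (KPow.continuous_update continuous_fst i
      (c.continuous_h.comp (((KPow.continuous_coord i).comp continuous_fst).prodMk
        continuous_snd)))
  -- Pushing the `i`-th coordinate along the collar makes the map agree with its restriction where
  -- `v < 1`, so the null homotopy of the restriction can be applied there.
  let f₁ : PointedMap (Z := KPow X n) (KPow.mk fun _ => x₀) x₀ :=
    ⟨⟨fun z => f.1 (z.update i (c.h (z.coord i, 1))),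
      hH.comp (continuous_id.prodMk continuous_const)⟩, by
      change f.1 (KPow.update _ i (c.h (x₀, 1))) = 1
      rw [c.h_base, KPow.update_base, f.2]⟩
  have h₁ : HomotopyClass.mk f = HomotopyClass.mk f₁ := by
    refine HomotopyClass.mk_eq_of_homotopy _ hH (fun z => ?_) (fun z => rfl) fun t => ?_
    · rw [c.h_zero, KPow.update_coord]
    · change f.1 (KPow.update _ i (c.h (x₀, t))) = 1
      rw [c.h_base, KPow.update_base, f.2]
  -- The factor `3 - 4 * v` is at least `1` for `v ≤ 1 / 2` and at most `0` for `v ≥ 3 / 4`: the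
  -- null homotopy runs fully near the hyperplane and not at all far from it.
  let B : KPow X n × I → James x₀ := fun p => if c.v (p.1.coord i) < 1 then
    N (p.1, truncate (p.2 * (3 - 4 * c.v (p.1.coord i)))) else f₁.1 p.1
  have hB1 : ∀ p : KPow X n × I, c.v (p.1.coord i) < 1 →
      B p = N (p.1, truncate (p.2 * (3 - 4 * c.v (p.1.coord i)))) := fun p hp => if_pos hp
  have hNf : ∀ z : KPow X n, c.v (z.coord i) < 1 → N (z, 0) = f₁.1 z := by
    intro z hz
    change N (z, 0) = f.1 (z.update i (c.h (z.coord i, 1)))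
    rw [hN0, c.h_one _ hz, PointedMap.restrict_apply]
  have hB2 : ∀ p : KPow X n × I, 3 / 4 ≤ c.v (p.1.coord i) → B p = f₁.1 p.1 := by
    intro p hp
    by_cases h : c.v (p.1.coord i) < 1
    · rw [hB1 p h, truncate_of_nonpos, hNf _ h]
      exact mul_nonpos_of_nonneg_of_nonpos p.2.2.1 (by linarith)
    · exact if_neg h
  have hBc : Continuous B := by
    have ho1 : IsOpen {p : KPow X n × I | c.v (p.1.coord i) < 1} :=
      isOpen_lt (hv.comp continuous_fst) continuous_const
    have ho2 : IsOpen {p : KPow X n × I | 3 / 4 < c.v (p.1.coord i)} :=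
      isOpen_lt continuous_const (hv.comp continuous_fst)
    rw [← continuousOn_univ, show (Set.univ : Set (KPow X n × I)) =
      {p | c.v (p.1.coord i) < 1} ∪ {p | 3 / 4 < c.v (p.1.coord i)} from ?_]
    · refine ContinuousOn.union_of_isOpen ?_ ?_ ho1 ho2
      · refine ContinuousOn.congr (Continuous.continuousOn ?_) hB1
        exact hN.comp (continuous_fst.prodMk (continuous_truncate.comp
          ((continuous_subtype_val.comp continuous_snd).mul
            (continuous_const.sub (continuous_const.mul (hv.comp continuous_fst))))))
      · exact (f₁.1.continuous.comp continuous_fst).continuousOn.congr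
          fun p hp => hB2 p (le_of_lt hp)
    · refine (Set.eq_univ_of_forall fun p => ?_).symm
      rcases lt_or_ge (c.v (p.1.coord i)) 1 with h | h
      · exact Or.inl h
      · exact Or.inr (lt_of_lt_of_le (by norm_num) h)
  have hBb : ∀ t, B (KPow.mk fun _ => x₀, t) = 1 := by
    intro t
    rw [hB1 _ (by change c.v x₀ < 1; rw [c.v_base]; norm_num), hNb]
  let f₂ : PointedMap (Z := KPow X n) (KPow.mk fun _ => x₀) x₀ :=
    ⟨⟨fun z => B (z, 1), hBc.comp (continuous_id.prodMk continuous_const)⟩, hBb 1⟩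
  refine ⟨f₂, ?_, fun z hz => ?_⟩
  · rw [h₁]
    refine (HomotopyClass.mk_eq_of_homotopy B hBc (fun z => ?_) (fun z => rfl) hBb).symm
    by_cases h : c.v (z.coord i) < 1
    · rw [hB1 _ h, Set.Icc.coe_zero, zero_mul, truncate_zero, hNf z h]
    · exact if_neg h
  · change B (z, 1) = 1
    rw [hB1 _ (by dsimp only; linarith), truncate_of_one_le, hN1]
    · rfl
    · rw [Set.Icc.coe_one]; linarith

end Restriction

/-! ### Commutativity of classes trivial on a common hyperplane -/

section Commutativity

variable {X : Type u} [TopologicalSpace X] {x₀ : X} {n : ℕ}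

/-- A difference of the two products of `f` and `g`, where the `i`-th coordinate is replaced by `x`
in `f` and by `x'` in `g`. At time `1` it vanishes if `x` or `x'` is the basepoint. -/
def productDifference (c : Collar x₀) (χ : James x₀ → James x₀) (D : James x₀ × I → James x₀)
    (i : Fin n) (f g : KPow X n → James x₀) (t : I) (x x' : X) (z : KPow X n) : James x₀ :=
  if min (c.v x) (c.v x') < 1 / 2 then
    D (f (z.update i x) * g (z.update i x'), truncate (t * (3 - 8 * min (c.v x) (c.v x'))))
  else f (z.update i x) * g (z.update i x') * χ (g (z.update i x') * f (z.update i x))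

variable {c : Collar x₀} {χ : James x₀ → James x₀} {D : James x₀ × I → James x₀} {i : Fin n}
  {f g : KPow X n → James x₀}

/-- If the minimum is below `1 / 2`, one of the two factors is `1`, so both products equal the same
`w` and the right side is `w * χ w`, the start of `D`. As `3 - 8 * m ≤ 0` for `m ≥ 3 / 8`, the two
branches of the definition agree for `3 / 8 ≤ m < 1 / 2`. -/
theorem productDifference_of_le (hD0 : ∀ w, D (w, 0) = w * χ w)
    (hf : ∀ z, c.v (z.coord i) ≤ 1 / 2 → f z = 1) (hg : ∀ z, c.v (z.coord i) ≤ 1 / 2 → g z = 1)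
    {t : I} {x x' : X} {z : KPow X n} (h : (t : ℝ) * (3 - 8 * min (c.v x) (c.v x')) ≤ 0) :
    productDifference c χ D i f g t x x' z =
      f (z.update i x) * g (z.update i x') * χ (g (z.update i x') * f (z.update i x)) := by
  rw [productDifference]
  split_ifs with hm
  · rw [truncate_of_nonpos h, hD0]
    rcases min_lt_iff.1 hm with h | h
    · rw [hf (z.update i x) (by rw [KPow.coord_update]; exact h.le), mul_one, one_mul]
    · rw [hg (z.update i x') (by rw [KPow.coord_update]; exact h.le), mul_one, one_mul]
  · rfl

theorem productDifference_one (hD1 : ∀ w, D (w, 1) = 1) {x x' : X} {z : KPow X n}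
    (h : min (c.v x) (c.v x') = 0) : productDifference c χ D i f g 1 x x' z = 1 := by
  rw [productDifference, h, if_pos (by norm_num), truncate_of_one_le (by norm_num), hD1]

theorem continuous_productDifference (hχ : Continuous χ) (hD : Continuous D)
    (hD0 : ∀ w, D (w, 0) = w * χ w) (hfc : Continuous f) (hgc : Continuous g)
    (hf : ∀ z, c.v (z.coord i) ≤ 1 / 2 → f z = 1) (hg : ∀ z, c.v (z.coord i) ≤ 1 / 2 → g z = 1)
    {T : Type u} [TopologicalSpace T] [CompactlyGeneratedSpace T] {t : T → I} {x x' : T → X}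
    {z : T → KPow X n} (ht : Continuous t) (hx : Continuous x) (hx' : Continuous x')
    (hz : Continuous z) :
    Continuous fun s => productDifference c χ D i f g (t s) (x s) (x' s) (z s) := by
  have hfx := hfc.comp (KPow.continuous_update hz i hx)
  have hgx := hgc.comp (KPow.continuous_update hz i hx')
  have hfg := James.continuous_mul x₀ hfx hgx
  have hm : Continuous fun s => min (c.v (x s)) (c.v (x' s)) := by fun_prop
  have ho1 : IsOpen {s | min (c.v (x s)) (c.v (x' s)) < 1 / 2} := isOpen_lt hm continuous_const
  have ho2 : IsOpen {s | 3 / 8 < min (c.v (x s)) (c.v (x' s))} := isOpen_lt continuous_const hm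
  rw [← continuousOn_univ, show (Set.univ : Set T) =
    {s | min (c.v (x s)) (c.v (x' s)) < 1 / 2} ∪ {s | 3 / 8 < min (c.v (x s)) (c.v (x' s))}
    from ?_]
  · refine ContinuousOn.union_of_isOpen ?_ ?_ ho1 ho2
    · refine ContinuousOn.congr (Continuous.continuousOn ?_) fun s hs => if_pos hs
      exact hD.comp (hfg.prodMk (by fun_prop))
    · refine ContinuousOn.congr (Continuous.continuousOn ?_) fun s hs =>
        productDifference_of_le hD0 hf hg
          (mul_nonpos_of_nonneg_of_nonpos (t s).2.1 ?_)
      · exact James.continuous_mul x₀ hfg (hχ.comp (James.continuous_mul x₀ hgx hfx))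
      · have : 3 / 8 < min (c.v (x s)) (c.v (x' s)) := hs
        linarith
  · refine (Set.eq_univ_of_forall fun s => ?_).symm
    rcases lt_or_ge (min (c.v (x s)) (c.v (x' s))) (1 / 2) with h | h
    · exact Or.inl h
    · exact Or.inr (lt_of_lt_of_le (by norm_num) h)

/-- The map induced by `productDifference` at time `1` on the smash product. -/
def smashDifference (c : Collar x₀) (χ : James x₀ → James x₀) {D : James x₀ × I → James x₀}
    (hD1 : ∀ w, D (w, 1) = 1) (i : Fin n) (f g : KPow X n → James x₀) (z : KPow X n) :
    SmashPower x₀ 2 → James x₀ :=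
  Quotient.lift (fun p => productDifference c χ D i f g 1 (p.coord 0) (p.coord 1) z) (by
    rintro p q (rfl | ⟨hp, hq⟩)
    · rfl
    · rw [productDifference_one hD1 (c.v_eq_zero_of_exists hp),
        productDifference_one hD1 (c.v_eq_zero_of_exists hq)])

variable [CompactlyGeneratedSpace X]

/-- The map `f * g * χ (g * f)` is deformed to one that depends on `zᵢ` through `zᵢ ∧ zᵢ` and on `z`
as a parameter. Contracting the reduced diagonal with the parameter fixed makes it trivial, and
cancelling `χ (g * f)` gives the claim. -/
theorem PowerClass.mk_commute (hcat : WeakLSCategoryLT x₀ 2) (c : Collar x₀) {i : Fin n}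
    {f g : PointedMap (Z := KPow X n) (KPow.mk fun _ => x₀) x₀}
    (hf : ∀ z, c.v (z.coord i) ≤ 1 / 2 → f.1 z = 1)
    (hg : ∀ z, c.v (z.coord i) ≤ 1 / 2 → g.1 z = 1) :
    HomotopyClass.mk f * HomotopyClass.mk g = HomotopyClass.mk g * HomotopyClass.mk f := by
  obtain ⟨χ, D, hχ, hD, hD0, hD1, hχb, hDb⟩ := James.exists_homotopyInverse c hcat
  let k : PointedMap (Z := KPow X n) (KPow.mk fun _ => x₀) x₀ :=
    ⟨⟨fun z => χ ((g * f).1 z), hχ.comp (g * f).1.continuous⟩, by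
      change χ ((g * f).1 _) = 1
      rw [(g * f).2, hχb]⟩
  have hgf : HomotopyClass.mk (g * f) * HomotopyClass.mk k = 1 := by
    rw [← HomotopyClass.mk_mul, ← HomotopyClass.mk_one]
    refine HomotopyClass.mk_eq_of_homotopy (fun p => D ((g * f).1 p.1, p.2)) (by fun_prop)
      (fun z => hD0 _) (fun z => hD1 _) fun t => ?_
    rw [(g * f).2, hDb]
  let A := productDifference c χ D i f.1 g.1
  have hA : ∀ {T : Type u} [TopologicalSpace T] [CompactlyGeneratedSpace T] {t : T → I}
      {x x' : T → X} {z : T → KPow X n}, Continuous t → Continuous x → Continuous x' →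
      Continuous z → Continuous fun s => A (t s) (x s) (x' s) (z s) := fun ht hx hx' hz =>
    continuous_productDifference hχ hD hD0 f.1.continuous g.1.continuous hf hg ht hx hx' hz
  have hAb : ∀ t, A t x₀ x₀ (KPow.mk fun _ => x₀) = 1 := by
    intro t
    change productDifference _ _ _ _ _ _ _ _ _ _ = _
    rw [productDifference, KPow.update_base, f.2, g.2, mul_one, hDb, if_pos]
    rw [c.v_base]; norm_num
  have hci : Continuous fun z : KPow X n => z.coord i := KPow.continuous_coord i
  let d : PointedMap (Z := KPow X n) (KPow.mk fun _ => x₀) x₀ :=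
    ⟨⟨fun z => A 1 (z.coord i) (z.coord i) z, hA continuous_const hci hci continuous_id⟩, hAb 1⟩
  have hfg : HomotopyClass.mk (f * g * k) = HomotopyClass.mk d := by
    refine HomotopyClass.mk_eq_of_homotopy (fun p => A p.2 (p.1.coord i) (p.1.coord i) p.1)
      (hA continuous_snd (hci.comp continuous_fst) (hci.comp continuous_fst) continuous_fst)
      (fun z => ?_) (fun z => rfl) hAb
    refine (productDifference_of_le hD0 hf hg (by simp)).trans ?_
    rw [KPow.update_coord]
    rfl
  have hd : HomotopyClass.mk d = 1 := by
    obtain ⟨G⟩ := hcat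
    rw [← HomotopyClass.mk_one]
    refine HomotopyClass.mk_eq_of_homotopy (fun p =>
      smashDifference c χ hD1 i f.1 g.1 p.1 (G (p.2, p.1.coord i))) ?_ (fun z => ?_) (fun z => ?_)
      fun t => ?_
    -- Over a compact parameter space `K`, the product of `X² → X ∧ X` with `K` is still a quotient
    -- map, which yields joint continuity in the smash point and the parameter.
    · refine continuous_from_compactlyGeneratedSpace _ fun K _ _ _ l hl => ?_
      have hs : Continuous fun p : SmashPower x₀ 2 × K =>
          smashDifference c χ hD1 i f.1 g.1 (l p.2).1 p.1 := by
        refine isQuotientMap_quotient_mk'.continuous_lift_prod_left ?_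
        have := CompactlyGeneratedSpace.prod_of_locallyCompact (KPow X 2) K
        exact hA (T := KPow X 2 × K) (t := fun _ => 1) continuous_const
          ((KPow.continuous_coord 0).comp continuous_fst)
          ((KPow.continuous_coord 1).comp continuous_fst)
          (continuous_fst.comp (hl.comp continuous_snd))
      exact hs.comp ((G.continuous.comp ((continuous_snd.comp hl).prodMk
        (hci.comp (continuous_fst.comp hl)))).prodMk continuous_id)
    · dsimp only
      rw [G.apply_zero]
      rfl
    · dsimp only
      rw [G.apply_one]
      exact productDifference_one hD1 (c.v_eq_zero_of_exists (p := KPow.mk fun _ => x₀) ⟨0, rfl⟩)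
    · change smashDifference c χ hD1 i f.1 g.1 _ (G (t, x₀)) = 1
      rw [G.eq_fst t rfl]
      exact hAb 1
  refine (HomotopyClass.isUnit c hcat (HomotopyClass.mk k)).mul_right_cancel ?_
  rw [← HomotopyClass.mk_mul g f, hgf, ← hd, ← hfg, HomotopyClass.mk_mul, HomotopyClass.mk_mul]

theorem PowerClass.commute_of_restrict_eq_one (hcat : WeakLSCategoryLT x₀ 2) (c : Collar x₀)
    {i : Fin n} {a b : PowerClass x₀ n} (ha : restrict x₀ i a = 1) (hb : restrict x₀ i b = 1) :
    a * b = b * a := by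
  obtain ⟨f, rfl, hf⟩ := exists_rep_of_restrict_eq_one c ha
  obtain ⟨g, rfl, hg⟩ := exists_rep_of_restrict_eq_one c hb
  exact mk_commute hcat c hf hg

end Commutativity

/-! ### Relations in groups generated by elements of abelian normal subgroups -/

section Algebra

variable {G : Type*} [Group G]

theorem map_iteratedCommutator {H : Type*} [Group H] (φ : G →* H) (l : List G) :
    φ (iteratedCommutator l) = iteratedCommutator (l.map φ) := by
  cases l with
  | nil => exact map_one φ
  | cons a l =>
    change φ (l.foldl cohenCommutator a) = (l.map φ).foldl cohenCommutator (φ a)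
    induction l generalizing a with
    | nil => rfl
    | cons b l ih =>
      rw [List.map_cons, List.foldl_cons, List.foldl_cons, ih]
      simp [cohenCommutator]

theorem iteratedCommutator_append_singleton {l : List G} (hl : l ≠ []) (a : G) :
    iteratedCommutator (l ++ [a]) = cohenCommutator (iteratedCommutator l) a := by
  cases l with
  | nil => exact absurd rfl hl
  | cons b l => exact List.foldl_concat cohenCommutator b a l

theorem cohenCommutator_mem_of_left {N : Subgroup G} [hN : N.Normal] {x : G} (hx : x ∈ N) (y : G) :
    cohenCommutator x y ∈ N := by
  have := N.mul_mem (N.inv_mem hx) (hN.conj_mem x hx y⁻¹)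
  simpa [cohenCommutator, mul_assoc] using this

theorem cohenCommutator_mem_of_right {N : Subgroup G} [hN : N.Normal] (x : G) {y : G}
    (hy : y ∈ N) : cohenCommutator x y ∈ N := by
  have := N.mul_mem (hN.conj_mem y⁻¹ (N.inv_mem hy) x⁻¹) hy
  simpa [cohenCommutator, mul_assoc] using this

/-- The commutator is the product of `x⁻¹` and a conjugate of `x`. Both lie in `N` and commute, so
powers distribute. -/
theorem cohenCommutator_zpow_left {N : Subgroup G} [hN : N.Normal]
    (hc : ∀ x ∈ N, ∀ y ∈ N, x * y = y * x) {x : G} (hx : x ∈ N) (y : G) (m : ℤ) :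
    cohenCommutator (x ^ m) y = cohenCommutator x y ^ m := by
  have h : ∀ x : G, cohenCommutator x y = x⁻¹ * (y⁻¹ * x * y⁻¹⁻¹) := fun x => by
    simp [cohenCommutator, mul_assoc]
  have hcomm : Commute x⁻¹ (y⁻¹ * x * y⁻¹⁻¹) := hc _ (N.inv_mem hx) _ (hN.conj_mem x hx y⁻¹)
  rw [h, h, hcomm.mul_zpow, conj_zpow, inv_zpow]

theorem cohenCommutator_zpow_right {N : Subgroup G} [hN : N.Normal]
    (hc : ∀ x ∈ N, ∀ y ∈ N, x * y = y * x) (x : G) {y : G} (hy : y ∈ N) (m : ℤ) :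
    cohenCommutator x (y ^ m) = cohenCommutator x y ^ m := by
  have h : ∀ y : G, cohenCommutator x y = (x⁻¹ * y⁻¹ * x⁻¹⁻¹) * y := fun y => by
    simp [cohenCommutator]
  have hcomm : Commute (x⁻¹ * y⁻¹ * x⁻¹⁻¹) y := hc _ (hN.conj_mem _ (N.inv_mem hy) x⁻¹) _ hy
  rw [h, h, hcomm.mul_zpow, conj_zpow, inv_zpow]

variable {ι : Type*} {a : ι → G} {N : ι → Subgroup G} [∀ i, (N i).Normal]

theorem iteratedCommutator_mem (ha : ∀ i, a i ∈ N i) {l : List ι} {i : ι} (hi : i ∈ l) :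
    iteratedCommutator (l.map a) ∈ N i := by
  induction l using List.reverseRecOn with
  | nil => simp at hi
  | append_singleton l j ih =>
    rcases eq_or_ne l [] with rfl | hl
    · obtain rfl : i = j := by simpa using hi
      exact ha i
    · rw [List.map_append, List.map_singleton,
        iteratedCommutator_append_singleton (by simpa using hl)]
      rcases List.mem_append.1 hi with h | h
      · exact cohenCommutator_mem_of_left (ih h) _
      · obtain rfl : i = j := by simpa using h
        exact cohenCommutator_mem_of_right _ (ha i)

/-- At the first repeated index `j`, the commutator formed so far already lies in `N j`, which is
abelian and contains `a j`. From there on all commutators are trivial. -/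
theorem iteratedCommutator_of_not_nodup (hc : ∀ i, ∀ x ∈ N i, ∀ y ∈ N i, x * y = y * x)
    (ha : ∀ i, a i ∈ N i) {l : List ι} (hl : ¬ l.Nodup) :
    iteratedCommutator (l.map a) = 1 := by
  induction l using List.reverseRecOn with
  | nil => simp at hl
  | append_singleton l j ih =>
    rcases eq_or_ne l [] with rfl | hl'
    · simp at hl
    · rw [List.map_append, List.map_singleton,
        iteratedCommutator_append_singleton (by simpa using hl')]
      by_cases h : l.Nodup
      · have hj : j ∈ l := by
          by_contra hj
          exact hl (List.nodup_append.2 ⟨h, List.nodup_singleton j, by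
            rintro x hx y hy rfl
            rw [List.mem_singleton] at hy
            exact hj (hy ▸ hx)⟩)
        have := hc j _ (iteratedCommutator_mem ha hj) _ (ha j)
        rw [cohenCommutator, mul_assoc, this]
        group
      · rw [ih h]
        simp [cohenCommutator]

/-- In the outermost commutator, the right entry lies in the abelian subgroup of its own index, the
left one in that of any index it involves. So exponents can be pulled out of both, one letter at a
time. -/
theorem iteratedCommutator_zpow (hc : ∀ i, ∀ x ∈ N i, ∀ y ∈ N i, x * y = y * x)
    (ha : ∀ i, a i ∈ N i) (l : List (ι × ℤ)) :
    iteratedCommutator (l.map fun p => a p.1 ^ p.2) =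
      iteratedCommutator (l.map fun p => a p.1) ^ (l.map Prod.snd).prod := by
  induction l using List.reverseRecOn with
  | nil => simp
  | append_singleton l p ih =>
    rcases eq_or_ne l [] with rfl | hl
    · simp [iteratedCommutator]
    · obtain ⟨q, hq⟩ := List.exists_mem_of_ne_nil l hl
      have hmem : iteratedCommutator (l.map fun p => a p.1) ∈ N q.1 := by
        have := iteratedCommutator_mem ha (List.mem_map_of_mem (f := Prod.fst) hq)
        rwa [List.map_map] at this
      simp only [List.map_append, List.map_singleton, List.prod_append, List.prod_singleton]
      rw [iteratedCommutator_append_singleton (by simpa using hl),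
        iteratedCommutator_append_singleton (by simpa using hl), ih,
        cohenCommutator_zpow_right (hc p.1) _ (ha p.1), cohenCommutator_zpow_left (hc q.1) hmem,
        zpow_mul]

end Algebra

theorem lift_cohenRelators_eq_one {G : Type*} [Group G] {n : ℕ} {a : Fin n → G}
    {N : Fin n → Subgroup G} [∀ i, (N i).Normal]
    (hc : ∀ i, ∀ x ∈ N i, ∀ y ∈ N i, x * y = y * x) (ha : ∀ i, a i ∈ N i) {r : FreeGroup (Fin n)}
    (hr : r ∈ cohenRelators n) : FreeGroup.lift a r = 1 := by
  rcases hr with ⟨l, hl, rfl⟩ | ⟨l, rfl⟩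
  · rw [map_iteratedCommutator, List.map_map]
    convert iteratedCommutator_of_not_nodup hc ha hl using 3
    funext i
    simp
  · rw [map_mul, map_inv, map_zpow, map_iteratedCommutator, map_iteratedCommutator, List.map_map,
      List.map_map, mul_inv_eq_one]
    convert iteratedCommutator_zpow hc ha l using 3
    · funext i
      simp
    · congr 1
      funext i
      simp

end

/-! ### The homomorphism from Cohen's group -/

theorem proposition2p2 {X : Type u} [TopologicalSpace X] [CompactlyGeneratedSpace X]
    [PathConnectedSpace X] (x₀ : X) (hx₀ : NondegenerateBasepoint x₀)
    (hcat : WeakLSCategoryLT x₀ 2) (n : ℕ) :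
    (∀ c : PowerClass x₀ n, IsUnit c) ∧
      ∃ e : CohenGroup n →* GeometricCohenGroup x₀ n, ∀ i : Fin n,
        ((e (PresentedGroup.of i) : (PowerClass x₀ n)ˣ) : PowerClass x₀ n) =
          coordinateClass x₀ i := by
  obtain ⟨c⟩ := hx₀.exists_collar
  have hunit : ∀ a : PowerClass x₀ n, IsUnit a := HomotopyClass.isUnit c hcat
  choose a ha using fun i : Fin n => hunit (coordinateClass x₀ i)
  let b : Fin n → GeometricCohenGroup x₀ n := fun i => ⟨a i, Subgroup.subset_closure ⟨i, ha i⟩⟩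
  -- Kernels of restriction to the coordinate hyperplanes: normal as kernels, abelian by the smash
  -- product argument.
  let N : Fin n → Subgroup (GeometricCohenGroup x₀ n) := fun i =>
    ((Units.map (PowerClass.restrict x₀ i)).comp (GeometricCohenGroup x₀ n).subtype).ker
  have hN : ∀ i (u : GeometricCohenGroup x₀ n),
      u ∈ N i ↔ PowerClass.restrict x₀ i ((u : (PowerClass x₀ n)ˣ) : PowerClass x₀ n) = 1 :=
    fun i u => Units.ext_iff
  have hc : ∀ i, ∀ u ∈ N i, ∀ w ∈ N i, u * w = w * u := fun i u hu w hw =>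
    Subtype.ext (Units.ext (PowerClass.commute_of_restrict_eq_one hcat c
      ((hN i u).1 hu) ((hN i w).1 hw)))
  have hb : ∀ i, b i ∈ N i := fun i => (hN i _).2 (by
    change PowerClass.restrict x₀ i (a i : PowerClass x₀ n) = 1
    rw [ha, PowerClass.restrict_coordinateClass])
  have : ∀ i, (N i).Normal := fun i => inferInstance
  refine ⟨hunit, PresentedGroup.toGroup fun r hr => lift_cohenRelators_eq_one hc hb hr,
    fun i => ?_⟩
  rw [PresentedGroup.toGroup.of]
  exact ha i
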